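/- Let $\Omega\subseteq\hat\Omega\subseteq\mathbb R^N$ be bounded domains (nonempty, open, connected) with $C^1$-boundaries (equality $\Omega=\hat\Omega$ is allowed) and let $1<p<\infty$. Let $Q_i:\Omega\times\mathbb R^N\to\mathbb R$ and $Q_e:\hat\Omega\times\mathbb R^N\to\mathbb R$ be measurable in the first variable, differentiable and strictly convex in the second variable, with $Q_i(x,0)=0$, $Q_e(x,0)=0$, and such that for some $\alpha>0$ one has $Q_i(x,y)\ge\alpha|y|^p$ for all $x\in\Omega$, $y\in\mathbb R^N$ and $Q_e(x,y)\ge\alpha|y|^p$ for all $x\in\hat\Omega$, $y\in\mathbb R^N$. Let $F\in C^1(\mathbb R^2)$ be semiconvex, that is, $(u,w)\mapsto F(u,w)+\frac{\omega_0}{2}(u^2+w^2)$ is convex for some $\omega_0\in\mathbb R$. Let $$V=\Big\{(u_i,u_e,w)\in W^{1,p}(\Omega)\times W^{1,p}(\hat\Omega)\times L^2(\Omega):\ \int_\Omega u_e=0,\ u_i-u_e|_\Omega\in L^2(\Omega)\Big\},$$ with the norm $\max\{\|u_i\|_{W^{1,p}(\Omega)},\|u_e\|_{W^{1,p}(\hat\Omega)},\|w\|_{L^2(\Omega)},\|u_i-u_e|_\Omega\|_{L^2(\Omega)}\}$,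 where $\|u\|_{W^{1,p}}=\max\{\|u\|_{L^p},\|\nabla u\|_{L^p}\}$. Let $H=L^2(\Omega)\times L^2(\Omega)$ with its Hilbert space norm, let $j:V\to H$ be the bounded linear map $j(u_i,u_e,w)=(u_i-u_e|_\Omega,w)$, and let $$\mathcal E(u_i,u_e,w)=\int_\Omega Q_i(x,\nabla u_i)\,dx+\int_{\hat\Omega}Q_e(x,\nabla u_e)\,dx+\int_\Omega F(u_i-u_e,w)\,dx .$$ Then: 1. The three integrals exist in $\mathbb R\cup\{+\infty\}$ for all $(u_i,u_e,w)\in V$, so that $\mathcal E:V\to\mathbb R\cup\{+\infty\}$ is well defined, and $\mathcal E$ is lower semicontinuous. 2. $\mathcal E$ is $j$-elliptic: there is $\omega\in\mathbb R$ such that $\mathcal E_\omega:=\mathcal E+\frac{\omega}{2}\|j(\cdot)\|_H^2$ is convex and coercive, the latter meaning that for every $c\in\mathbb R$ the sublevel set $\{\mathcal E_\omega\le c\}$ is relatively weakly compact in $V$. 3. The effective domain $\operatorname{dom}\mathcal E:=\{\mathcal E<+\infty\}$ is the set of all $(u_i,u_e,w)\in V$ for which $\int_\Omega Q_i(x,\nabla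 u_i)$, $\int_{\hat\Omega}Q_e(x,\nabla u_e)$ and $\int_\Omega F(u_i-u_e,w)$ are all $<+\infty$. 4. If, in addition, $Q_i(\cdot,y)\in L^1_{\mathrm{loc}}(\Omega)$ for every $y\in\mathbb R^N$, then $j(\operatorname{dom}\mathcal E)$ is dense in $L^2(\Omega)\times L^2(\Omega)$. -/

import Mathlib

open MeasureTheory Filter Topology
open scoped ENNReal

noncomputable section

namespace Bidomain

/-- `ℝᴺ` with the Euclidean norm. -/
abbrev Eucl (N : ℕ) := EuclideanSpace ℝ (Fin N)

/-- Lebesgue measure on `Ω`. -/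
abbrev leb {N : ℕ} (Ω : Set (Eucl N)) : Measure (Eucl N) := volume.restrict Ω

/-- `Ω` has a `C¹`-boundary: near each boundary point, `Ω` is the region strictly above the graph
of a `C¹` function, in an orthonormal coordinate system with "vertical" direction `e`
(the remaining coordinates are those of the hyperplane `e⊥`). -/
def HasC1Boundary {N : ℕ} (Ω : Set (Eucl N)) : Prop :=
  ∀ x₀ ∈ frontier Ω, ∃ r > (0 : ℝ), ∃ e : Eucl N, ‖e‖ = 1 ∧
    ∃ γ : (Submodule.span ℝ {e})ᗮ → ℝ, ContDiff ℝ 1 γ ∧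
      ∀ x ∈ Metric.ball x₀ r,
        x ∈ Ω ↔ γ ((Submodule.span ℝ {e})ᗮ.orthogonalProjectionOnto x) < inner ℝ e x

/-- A bounded domain (nonempty, open, connected) with `C¹`-boundary. -/
structure IsC1Domain {N : ℕ} (Ω : Set (Eucl N)) : Prop where
  isOpen : IsOpen Ω
  isConnected : IsConnected Ω
  isBounded : Bornology.IsBounded Ω
  hasC1Boundary : HasC1Boundary Ω

/-- `g` is the weak gradient of `u` on `Ω`. -/
def IsWeakGradient {N : ℕ} (Ω : Set (Eucl N)) (u : Eucl N → ℝ) (g : Eucl N → Eucl N) : Prop :=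
  ∀ φ : Eucl N → ℝ, ContDiff ℝ (⊤ : ℕ∞) φ → HasCompactSupport φ → tsupport φ ⊆ Ω →
    ∀ y : Eucl N, ∫ x in Ω, fderiv ℝ φ x y * u x = - ∫ x in Ω, φ x * inner ℝ (g x) y

theorem integrable_testFunction_mul {N : ℕ} {p : ℝ≥0∞} (hp : 1 ≤ p) {Ω : Set (Eucl N)}
    {f u : Eucl N → ℝ} (hf : Continuous f) (hf' : HasCompactSupport f) (hu : MemLp u p (leb Ω)) :
    Integrable (fun x => f x * u x) (leb Ω) := by
  simpa using (hu.locallyIntegrable hp).integrable_smul_left_of_hasCompactSupport hf hf'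

/-- The Sobolev space `W^{1,p}(Ω)`, as the space of pairs `(u, ∇u)` in `Lᵖ(Ω) × Lᵖ(Ω; ℝᴺ)`, where
`∇u` is the weak gradient of `u`; the norm is `max ‖u‖_p ‖∇u‖_p`. -/
def Sobolev {N : ℕ} (p : ℝ≥0∞) [Fact (1 ≤ p)] (Ω : Set (Eucl N)) :
    Submodule ℝ (Lp ℝ p (leb Ω) × Lp (Eucl N) p (leb Ω)) where
  carrier := {u | IsWeakGradient Ω u.1 u.2}
  zero_mem' := by
    intro φ _ _ _ y
    have h1 : ∫ x in Ω, fderiv ℝ φ x y * (0 : Lp ℝ p (leb Ω)) x = 0 := by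
      refine integral_eq_zero_of_ae ?_
      filter_upwards [Lp.coeFn_zero ℝ p (leb Ω)] with x hx
      rw [hx]; simp
    have h2 : ∫ x in Ω, φ x * inner ℝ ((0 : Lp (Eucl N) p (leb Ω)) x) y = 0 := by
      refine integral_eq_zero_of_ae ?_
      filter_upwards [Lp.coeFn_zero (Eucl N) p (leb Ω)] with x hx
      rw [hx]; simp
    exact h1.trans (by rw [← neg_zero, ← h2]; rfl)
  add_mem' := by
    rintro ⟨u, g⟩ ⟨v, h⟩ hu hv φ hφ hφc hφs y
    have hp : (1 : ℝ≥0∞) ≤ p := Fact.out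
    have hd : Continuous fun x => fderiv ℝ φ x y :=
      (hφ.continuous_fderiv (by simp)).clm_apply continuous_const
    have hdc : HasCompactSupport fun x => fderiv ℝ φ x y := hφc.fderiv_apply ℝ y
    have e1 : ∫ x in Ω, fderiv ℝ φ x y * (u + v : Lp ℝ p (leb Ω)) x =
        (∫ x in Ω, fderiv ℝ φ x y * u x) + ∫ x in Ω, fderiv ℝ φ x y * v x := by
      rw [← integral_add (integrable_testFunction_mul hp hd hdc (Lp.memLp u))
        (integrable_testFunction_mul hp hd hdc (Lp.memLp v))]
      refine integral_congr_ae ?_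
      filter_upwards [Lp.coeFn_add u v] with x hx
      rw [hx, Pi.add_apply, mul_add]
    have e2 : ∫ x in Ω, φ x * inner ℝ ((g + h : Lp (Eucl N) p (leb Ω)) x) y =
        (∫ x in Ω, φ x * inner ℝ (g x) y) + ∫ x in Ω, φ x * inner ℝ (h x) y := by
      rw [← integral_add
        (integrable_testFunction_mul hp hφ.continuous hφc ((Lp.memLp g).inner_const y))
        (integrable_testFunction_mul hp hφ.continuous hφc ((Lp.memLp h).inner_const y))]
      refine integral_congr_ae ?_
      filter_upwards [Lp.coeFn_add g h] with x hx
      rw [hx, Pi.add_apply, inner_add_left, mul_add]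
    have a1 := hu φ hφ hφc hφs y
    have a2 := hv φ hφ hφc hφs y
    simp only [Prod.mk_add_mk] at a1 a2 ⊢
    rw [e1, e2, a1, a2]
    ring
  smul_mem' := by
    rintro c ⟨u, g⟩ hu φ hφ hφc hφs y
    have e1 : ∫ x in Ω, fderiv ℝ φ x y * (c • u : Lp ℝ p (leb Ω)) x =
        c * ∫ x in Ω, fderiv ℝ φ x y * u x := by
      rw [← integral_const_mul]
      refine integral_congr_ae ?_
      filter_upwards [Lp.coeFn_smul c u] with x hx
      simp [hx]; ring
    have e2 : ∫ x in Ω, φ x * inner ℝ ((c • g : Lp (Eucl N) p (leb Ω)) x) y =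
        c * ∫ x in Ω, φ x * inner ℝ (g x) y := by
      rw [← integral_const_mul]
      refine integral_congr_ae ?_
      filter_upwards [Lp.coeFn_smul c g] with x hx
      simp [hx, inner_smul_left]; ring
    have a1 := hu φ hφ hφc hφs y
    simp only [Prod.smul_mk] at a1 ⊢
    rw [e1, e2, a1]
    ring

/-- The real Hilbert space `L²(Ω) × L²(Ω)`. -/
abbrev HilbertL2 {N : ℕ} (Ω : Set (Eucl N)) :=
  WithLp 2 (Lp ℝ 2 (leb Ω) × Lp ℝ 2 (leb Ω))

theorem integrable_restrict {N : ℕ} {p : ℝ≥0∞} (hp : 1 ≤ p) {Ω Ω' : Set (Eucl N)} (hΩ : Ω ⊆ Ω')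
    (hb : Bornology.IsBounded Ω) (u : Lp ℝ p (leb Ω')) : Integrable u (leb Ω) := by
  have : IsFiniteMeasure (leb Ω) := ⟨by simpa using hb.measure_lt_top⟩
  exact ((Lp.memLp u).mono_measure (Measure.restrict_mono hΩ le_rfl)).integrable hp

/-- The energy space `V` of all `(u_i, u_e, w)` in `W^{1,p}(Ω) × W^{1,p}(Ω') × L²(Ω)` such that
`∫_Ω u_e = 0` and `u_i - u_e|_Ω ∈ L²(Ω)`. The `L²` class `v` of `u_i - u_e|_Ω` is recorded as a
fourth component (which is determined by the first two), so that the norm inherited from the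
product is the canonical one,
`max (‖u_i‖_{W^{1,p}}) (‖u_e‖_{W^{1,p}}) (‖w‖_{L²}) (‖u_i - u_e‖_{L²})`. -/
def EnergySpace {N : ℕ} (p : ℝ≥0∞) [Fact (1 ≤ p)] {Ω Ω' : Set (Eucl N)} (hΩ : Ω ⊆ Ω')
    (hb : Bornology.IsBounded Ω) :
    Submodule ℝ (Sobolev p Ω × Sobolev p Ω' × Lp ℝ 2 (leb Ω) × Lp ℝ 2 (leb Ω)) where
  carrier := {z | ∫ x in Ω, z.2.1.1.1 x = 0 ∧
    z.2.2.2 =ᵐ[leb Ω] fun x => z.1.1.1 x - z.2.1.1.1 x}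
  zero_mem' := by
    have h0 : ((0 : Lp ℝ p (leb Ω')) : Eucl N → ℝ) =ᵐ[leb Ω] 0 :=
      ae_mono (Measure.restrict_mono hΩ le_rfl) (Lp.coeFn_zero ℝ p (leb Ω'))
    refine ⟨integral_eq_zero_of_ae h0, ?_⟩
    filter_upwards [h0, Lp.coeFn_zero ℝ p (leb Ω), Lp.coeFn_zero ℝ 2 (leb Ω)] with x h1 h2 h3
    refine h3.trans ?_
    refine Eq.trans ?_ (congrArg₂ (· - ·) h2 h1).symm
    simp
  add_mem' := by
    rintro ⟨a, b, w, v⟩ ⟨a', b', w', v'⟩ ⟨h1, h2⟩ ⟨h1', h2'⟩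
    have hp : (1 : ℝ≥0∞) ≤ p := Fact.out
    have h0 : ((b.1.1 + b'.1.1 : Lp ℝ p (leb Ω')) : Eucl N → ℝ) =ᵐ[leb Ω]
        fun x => b.1.1 x + b'.1.1 x :=
      ae_mono (Measure.restrict_mono hΩ le_rfl) (Lp.coeFn_add b.1.1 b'.1.1)
    refine ⟨?_, ?_⟩
    · have e : ∫ x in Ω, (b.1.1 + b'.1.1 : Lp ℝ p (leb Ω')) x = 0 := by
        rw [integral_congr_ae h0, integral_add (integrable_restrict hp hΩ hb _)
          (integrable_restrict hp hΩ hb _)]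
        simp only at h1 h1'
        rw [h1, h1', add_zero]
      simpa using e
    · filter_upwards [h0, h2, h2', Lp.coeFn_add a.1.1 a'.1.1, Lp.coeFn_add v v']
        with x k0 k1 k2 k3 k4
      simp only [Prod.mk_add_mk, Submodule.coe_add, Prod.fst_add] at k0 k1 k2 k3 k4 ⊢
      rw [k0, k3, k4, Pi.add_apply, Pi.add_apply, k1, k2]
      ring
  smul_mem' := by
    rintro c ⟨a, b, w, v⟩ ⟨h1, h2⟩
    have h0 : ((c • b.1.1 : Lp ℝ p (leb Ω')) : Eucl N → ℝ) =ᵐ[leb Ω] fun x => c * b.1.1 x :=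
      ae_mono (Measure.restrict_mono hΩ le_rfl) (Lp.coeFn_smul c b.1.1)
    refine ⟨?_, ?_⟩
    · have e : ∫ x in Ω, (c • b.1.1 : Lp ℝ p (leb Ω')) x = 0 := by
        rw [integral_congr_ae h0, integral_const_mul]
        simp only at h1
        rw [h1, mul_zero]
      simpa using e
    · filter_upwards [h0, h2, Lp.coeFn_smul c a.1.1, Lp.coeFn_smul c v] with x k0 k1 k2 k3
      simp only [Prod.smul_mk, Submodule.coe_smul, Prod.smul_fst] at k0 k1 k2 k3 ⊢
      rw [k0, k2, k3, Pi.smul_apply, Pi.smul_apply, k1]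
      simp only [smul_eq_mul]
      ring

section Components

variable {N : ℕ} {p : ℝ≥0∞} [Fact (1 ≤ p)] {Ω Ω' : Set (Eucl N)} {hΩ : Ω ⊆ Ω'}
  {hb : Bornology.IsBounded Ω}

/-- The component `u_i` of `z = (u_i, u_e, w)`. -/
def uᵢ (z : EnergySpace p hΩ hb) : Eucl N → ℝ := z.1.1.1.1

/-- The weak gradient of `u_i`. -/
def gradUᵢ (z : EnergySpace p hΩ hb) : Eucl N → Eucl N := z.1.1.1.2

/-- The component `u_e` of `z = (u_i, u_e, w)`. -/
def uₑ (z : EnergySpace p hΩ hb) : Eucl N → ℝ := z.1.2.1.1.1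

/-- The weak gradient of `u_e`. -/
def gradUₑ (z : EnergySpace p hΩ hb) : Eucl N → Eucl N := z.1.2.1.1.2

/-- The component `w` of `z = (u_i, u_e, w)`. -/
def wComp (z : EnergySpace p hΩ hb) : Eucl N → ℝ := z.1.2.2.1

end Components

/-- The map `j : V → L²(Ω) × L²(Ω)`, `j (u_i, u_e, w) = (u_i - u_e|_Ω, w)`. -/
def jMap {N : ℕ} (p : ℝ≥0∞) [Fact (1 ≤ p)] {Ω Ω' : Set (Eucl N)} (hΩ : Ω ⊆ Ω')
    (hb : Bornology.IsBounded Ω) : EnergySpace p hΩ hb →L[ℝ] HilbertL2 Ω :=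
  ((WithLp.prodContinuousLinearEquiv 2 ℝ (Lp ℝ 2 (leb Ω)) (Lp ℝ 2 (leb Ω))).symm :
      (Lp ℝ 2 (leb Ω) × Lp ℝ 2 (leb Ω)) →L[ℝ] HilbertL2 Ω) ∘L
    ContinuousLinearMap.prod
      (ContinuousLinearMap.snd ℝ _ _ ∘L ContinuousLinearMap.snd ℝ _ _ ∘L
        ContinuousLinearMap.snd ℝ _ _ ∘L (EnergySpace p hΩ hb).subtypeL)
      (ContinuousLinearMap.fst ℝ _ _ ∘L ContinuousLinearMap.snd ℝ _ _ ∘L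
        ContinuousLinearMap.snd ℝ _ _ ∘L (EnergySpace p hΩ hb).subtypeL)

theorem jMap_fst {N : ℕ} {p : ℝ≥0∞} [Fact (1 ≤ p)] {Ω Ω' : Set (Eucl N)} {hΩ : Ω ⊆ Ω'}
    {hb : Bornology.IsBounded Ω} (z : EnergySpace p hΩ hb) :
    (jMap p hΩ hb z).fst =ᵐ[leb Ω] fun x => uᵢ z x - uₑ z x :=
  z.2.2

theorem jMap_snd {N : ℕ} {p : ℝ≥0∞} [Fact (1 ≤ p)] {Ω Ω' : Set (Eucl N)} {hΩ : Ω ⊆ Ω'}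
    {hb : Bornology.IsBounded Ω} (z : EnergySpace p hΩ hb) :
    ((jMap p hΩ hb z).snd : Eucl N → ℝ) = wComp z :=
  rfl

/-- The integral of a real function in the extended reals, `∫ f⁺ - ∫ f⁻`. It takes the value `⊥`
as soon as `∫ f⁻ = ∞` (also if `∫ f⁺ = ∞`); otherwise it is the usual integral in `(-∞, +∞]`. -/
def extIntegral {α : Type*} [MeasurableSpace α] (μ : Measure α) (f : α → ℝ) : EReal :=
  ((∫⁻ x, ENNReal.ofReal (f x) ∂μ : ℝ≥0∞) : EReal) -
    ((∫⁻ x, ENNReal.ofReal (-f x) ∂μ : ℝ≥0∞) : EReal)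

section Energy

variable {N : ℕ} {p : ℝ≥0∞} [Fact (1 ≤ p)] {Ω Ω' : Set (Eucl N)} {hΩ : Ω ⊆ Ω'}
  {hb : Bornology.IsBounded Ω}

/-- `∫_Ω Q_i(x, ∇u_i)`. -/
def energyᵢ (Qᵢ : Eucl N → Eucl N → ℝ) (z : EnergySpace p hΩ hb) : EReal :=
  extIntegral (leb Ω) fun x => Qᵢ x (gradUᵢ z x)

/-- `∫_Ω' Q_e(x, ∇u_e)`. -/
def energyₑ (Qₑ : Eucl N → Eucl N → ℝ) (z : EnergySpace p hΩ hb) : EReal :=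
  extIntegral (leb Ω') fun x => Qₑ x (gradUₑ z x)

/-- `∫_Ω F(u_i - u_e, w)`. -/
def energyF (F : ℝ × ℝ → ℝ) (z : EnergySpace p hΩ hb) : EReal :=
  extIntegral (leb Ω) fun x => F (uᵢ z x - uₑ z x, wComp z x)

end Energy

/-- The bidomain energy. -/
def energy {N : ℕ} (p : ℝ≥0∞) [Fact (1 ≤ p)] {Ω Ω' : Set (Eucl N)} (hΩ : Ω ⊆ Ω')
    (hb : Bornology.IsBounded Ω) (Qᵢ Qₑ : Eucl N → Eucl N → ℝ) (F : ℝ × ℝ → ℝ)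
    (z : EnergySpace p hΩ hb) : EReal :=
  energyᵢ Qᵢ z + energyₑ Qₑ z + energyF F z

/-- The assumptions on `Q : Ω × ℝᴺ → ℝ`: (Lebesgue) measurable in the first variable,
differentiable and strictly convex in the second, `Q(x,0) = 0` and `Q(x,y) ≥ α |y|ᵖ`. -/
structure IsFluxPotential {N : ℕ} (p : ℝ≥0∞) (Ω : Set (Eucl N)) (Q : Eucl N → Eucl N → ℝ) :
    Prop where
  aemeasurable : ∀ y, AEMeasurable (fun x => Q x y) (leb Ω)
  differentiable : ∀ x ∈ Ω, Differentiable ℝ (Q x)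
  strictConvexOn : ∀ x ∈ Ω, StrictConvexOn ℝ Set.univ (Q x)
  map_zero : ∀ x ∈ Ω, Q x 0 = 0
  lower_bound : ∃ α > (0 : ℝ), ∀ x ∈ Ω, ∀ y, α * ‖y‖ ^ p.toReal ≤ Q x y

/-- `F : ℝ² → ℝ` is semiconvex. -/
def IsSemiconvex (F : ℝ × ℝ → ℝ) : Prop :=
  ∃ ω : ℝ, ConvexOn ℝ Set.univ fun z : ℝ × ℝ => F z + ω / 2 * (z.1 ^ 2 + z.2 ^ 2)

section Abstract

variable {V H : Type*} [NormedAddCommGroup V] [NormedSpace ℝ V]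
  [NormedAddCommGroup H] [InnerProductSpace ℝ H]

/-- The effective domain `{E < ∞}`. -/
def effDom (E : V → EReal) : Set V := {u | E u < ⊤}

/-- `E_ω = E + (ω/2) ‖j ·‖²`. -/
def shifted (E : V → EReal) (j : V →L[ℝ] H) (ω : ℝ) (u : V) : EReal :=
  E u + ((ω / 2 * ‖j u‖ ^ 2 : ℝ) : EReal)

/-- Convexity of a function with values in `ℝ ∪ {+∞}`. -/
def IsConvexFun (E : V → EReal) : Prop :=
  ∀ u v : V, ∀ a b : ℝ, 0 ≤ a → 0 ≤ b → a + b = 1 →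
    E (a • u + b • v) ≤ (a : EReal) * E u + (b : EReal) * E v

/-- Coercivity: all sublevel sets `{E ≤ c}` are relatively weakly compact. -/
def IsCoerciveFun (E : V → EReal) : Prop :=
  ∀ c : ℝ, IsCompact (closure (toWeakSpace ℝ V '' {u | E u ≤ (c : EReal)}))

/-- `j`-ellipticity: `E_ω` is convex and coercive for some real `ω`. -/
def IsJElliptic (E : V → EReal) (j : V →L[ℝ] H) : Prop :=
  ∃ ω : ℝ, IsConvexFun (shifted E j ω) ∧ IsCoerciveFun (shifted E j ω)

end Abstract

end Bidomain

end

open MeasureTheory Filter Topology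
open scoped ENNReal

noncomputable section

namespace Bidomain

/-! ### Reflexive spaces: weak compactness and permanence properties. -/

section Reflexive

/-! Semiconvexity and differentiability of `F` give constants ω, C such that G(v,w) = F(v,w) +
(ω/2)(v² + w²) + C is convex and G(v,w) ≥ v² + w² (`IsSemiconvex.exists_convexOn`). Since v = u_i -
u_e and w lie in L²(Ω) and |Ω| < ∞, the added term is integrable, and E = K - (ω/2)‖j‖² - C|Ω|
(`energy_eq`), where K sums three integrals of nonnegative convex integrands. Hence no ∞ - ∞ occurs,
the effective domain is {K < ∞}, and E_ω is K minus a constant. Convexity of K is pointwise; lower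
semicontinuity is Fatou's lemma along a.e. convergent subsequences.

For coercivity, V is a closed subspace of a product of Lᵖ and L² spaces, hence reflexive
(`isReflexiveSpace_energySpace`), and bounded sets are relatively weakly compact. It remains to
bound the sublevel sets of K. K controls ∇u_i, ∇u_e, v and w; the functions u_i, u_e themselves are
controlled by the Poincaré inequality, because u_e has mean zero over Ω and u_i has the same mean
there as v.

The Poincaré inequality is proved without compact embeddings. Mollification gives ‖u(· + h) - u‖ ≤
|h| ‖∇u‖ wherever the segments stay in Ω (`lintegral_translate_sub_le`). Averaging over h yields the
inequality on balls, pushing inward along the graph direction carries it to neighbourhoods of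
boundary points, and connectedness glues a finite cover (`isPoincareSet_of_locally`).

For density, the elements (φ, 0, ψ) with φ, ψ ∈ C_c^∞(Ω) have finite energy: ∇φ takes values in a
polytope, on which convexity bounds Q_i by its locally integrable values at the vertices. Their
images (φ, ψ) are dense. -/

/-- A normed space is reflexive if the canonical map into the bidual is onto. -/
def IsReflexiveSpace (E : Type*) [NormedAddCommGroup E] [NormedSpace ℝ E] : Prop :=
  Function.Surjective (NormedSpace.inclusionInDoubleDual ℝ E)

variable {E F : Type*} [NormedAddCommGroup E] [NormedSpace ℝ E]
  [NormedAddCommGroup F] [NormedSpace ℝ F]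

theorem isReflexiveSpace_iff :
    IsReflexiveSpace E ↔ ∀ Φ : StrongDual ℝ (StrongDual ℝ E), ∃ x : E, ∀ f : StrongDual ℝ E,
      Φ f = f x := by
  refine forall_congr' fun Φ => exists_congr fun x => ?_
  rw [ContinuousLinearMap.ext_iff]
  exact forall_congr' fun f => by rw [NormedSpace.dual_def, eq_comm]

/-- Banach–Alaoglu in the bidual: weak-* limits of the image of S come from E again, since the
canonical map is onto. -/
theorem IsReflexiveSpace.isCompact_closure (hE : IsReflexiveSpace E) {S : Set E}
    (hS : Bornology.IsBounded S) : IsCompact (closure (toWeakSpace ℝ E '' S)) := by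
  refine NormedSpace.isCompact_closure_of_isBounded ℝ E _ ?_ ?_
  · rwa [Set.preimage_image_eq _ (toWeakSpace ℝ E).injective]
  · intro Φ _
    obtain ⟨x, hx⟩ := hE (WeakDual.toStrongDual Φ)
    refine ⟨toWeakSpace ℝ E x, ?_⟩
    apply WeakDual.toStrongDual.injective
    exact hx

/-- Restricting Φ to functionals that factor through one projection gives each coordinate; every
functional on the product is a sum of two such. -/
theorem IsReflexiveSpace.prod (hE : IsReflexiveSpace E) (hF : IsReflexiveSpace F) :
    IsReflexiveSpace (E × F) := by
  rw [isReflexiveSpace_iff] at *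
  intro Φ
  obtain ⟨x, hx⟩ := hE (Φ ∘L (ContinuousLinearMap.fst ℝ E F).precomp ℝ)
  obtain ⟨y, hy⟩ := hF (Φ ∘L (ContinuousLinearMap.snd ℝ E F).precomp ℝ)
  refine ⟨(x, y), fun f => ?_⟩
  have hf : f = (f ∘L ContinuousLinearMap.inl ℝ E F) ∘L ContinuousLinearMap.fst ℝ E F +
      (f ∘L ContinuousLinearMap.inr ℝ E F) ∘L ContinuousLinearMap.snd ℝ E F := by
    ext <;> simp [Prod.mk_zero_zero]
  have h1 := hx (f ∘L ContinuousLinearMap.inl ℝ E F)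
  have h2 := hy (f ∘L ContinuousLinearMap.inr ℝ E F)
  simp only [ContinuousLinearMap.comp_apply, ContinuousLinearMap.precomp_apply] at h1 h2
  conv_lhs => rw [hf]
  rw [map_add, h1, h2, ← map_add]
  simp

theorem IsReflexiveSpace.pi {ι : Type*} [Fintype ι] [DecidableEq ι] {E : ι → Type*}
    [∀ i, NormedAddCommGroup (E i)] [∀ i, NormedSpace ℝ (E i)]
    (hE : ∀ i, IsReflexiveSpace (E i)) : IsReflexiveSpace (∀ i, E i) := by
  simp only [isReflexiveSpace_iff] at *
  intro Φ
  choose x hx using fun i => hE i (Φ ∘L (ContinuousLinearMap.proj (R := ℝ) (φ := E) i).precomp ℝ)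
  refine ⟨x, fun f => ?_⟩
  have hf : f = ∑ i, (f ∘L ContinuousLinearMap.single ℝ E i) ∘L ContinuousLinearMap.proj i := by
    ext y
    simp only [sum_apply, ContinuousLinearMap.comp_apply,
      ContinuousLinearMap.proj_apply, ContinuousLinearMap.single_apply]
    rw [← map_sum, Finset.univ_sum_single]
  have h1 : ∀ i, Φ ((f ∘L ContinuousLinearMap.single ℝ E i) ∘L ContinuousLinearMap.proj i) =
      f (Pi.single i (x i)) := fun i => hx i (f ∘L ContinuousLinearMap.single ℝ E i)
  conv_lhs => rw [hf]
  rw [map_sum, Finset.sum_congr rfl fun i _ => h1 i, ← map_sum, Finset.univ_sum_single]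

/-- A retract of a reflexive space is reflexive. -/
theorem IsReflexiveSpace.of_leftInverse (hF : IsReflexiveSpace F) (T : E →L[ℝ] F) (S : F →L[ℝ] E)
    (h : Function.LeftInverse S T) : IsReflexiveSpace E := by
  rw [isReflexiveSpace_iff] at *
  intro Φ
  obtain ⟨y, hy⟩ := hF (Φ ∘L T.precomp ℝ)
  refine ⟨S y, fun e => ?_⟩
  have he : (e ∘L S) ∘L T = e := by
    ext x
    simp [h x]
  have := hy (e ∘L S)
  simpa only [ContinuousLinearMap.comp_apply, ContinuousLinearMap.precomp_apply, he] using this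

/-- A Banach space which embeds into a reflexive space is reflexive. -/
theorem IsReflexiveSpace.of_antilipschitz [CompleteSpace E] (hF : IsReflexiveSpace F)
    (T : E →L[ℝ] F) {K : NNReal} (hT : AntilipschitzWith K T) : IsReflexiveSpace E := by
  rw [isReflexiveSpace_iff] at *
  intro Φ
  obtain ⟨y, hy⟩ := hF (Φ ∘L T.precomp ℝ)
  have hcl : IsClosed (T.range : Set F) := by
    have h := hT.isClosed_range T.uniformContinuous
    rwa [LinearMap.coe_range]
  -- Otherwise Hahn–Banach separates y from the closed range by some f; then f vanishes on the
  -- range, and f y = Φ (f ∘ T) = Φ 0 = 0 contradicts the separation.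
  have hyT : y ∈ T.range := by
    by_contra hne
    obtain ⟨f, u, hu, hu'⟩ := geometric_hahn_banach_closed_point T.range.convex hcl hne
    have hfT : f ∘L T = 0 := by
      ext w
      by_contra hw
      -- f stays strictly below u on a subspace, but this multiple of w is scaled so that f equals
      -- u.
      have h := hu (T ((u / f (T w)) • w)) ⟨_, rfl⟩
      have hw' : f (T w) ≠ 0 := hw
      rw [map_smul, map_smul, smul_eq_mul, div_mul_cancel₀ _ hw'] at h
      exact lt_irrefl _ h
    have h0 := hu 0 (Submodule.zero_mem _)
    have h1 := hy f
    simp only [ContinuousLinearMap.comp_apply, ContinuousLinearMap.precomp_apply, hfT] at h1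
    rw [map_zero] at h0 h1
    linarith
  obtain ⟨x, rfl⟩ := hyT
  refine ⟨x, fun e => ?_⟩
  let S : T.range →ₗ[ℝ] E := (LinearEquiv.ofInjective (T : E →ₗ[ℝ] F) hT.injective).symm
  have hS : ∀ v, ‖S v‖ ≤ K * ‖v‖ := by
    intro v
    obtain ⟨w, rfl⟩ := (LinearEquiv.ofInjective (T : E →ₗ[ℝ] F) hT.injective).surjective v
    simp only [S, LinearEquiv.coe_coe, LinearEquiv.symm_apply_apply]
    simpa using hT.le_mul_dist w 0
  -- Every functional e on E has the form f ∘ T: extend e ∘ T⁻¹ from the range of T.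
  obtain ⟨f, hf, -⟩ := exists_extension_norm_eq _ (e ∘L S.mkContinuous K hS)
  have hfe : f ∘L T = e := by
    ext w
    have := hf ((LinearEquiv.ofInjective (T : E →ₗ[ℝ] F) hT.injective) w)
    simpa [S] using this
  have := hy f
  simp only [ContinuousLinearMap.comp_apply, ContinuousLinearMap.precomp_apply, hfe] at this
  rw [this]
  exact congrArg (fun g : StrongDual ℝ E => g x) hfe

theorem IsReflexiveSpace.submodule [CompleteSpace E] (hE : IsReflexiveSpace E) {S : Submodule ℝ E}
    (hS : IsClosed (S : Set E)) : IsReflexiveSpace S :=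
  have := hS.completeSpace_coe
  hE.of_antilipschitz S.subtypeL S.subtypeₗᵢ.antilipschitz

end Reflexive

/-! ### Duality and reflexivity of Lᵖ over a finite measure. -/

section LpDual

variable {α : Type*} [MeasurableSpace α] {μ : Measure α} [IsFiniteMeasure μ] {p : ℝ≥0∞}

theorem indicatorConstLp_biUnion_finset {A : ℕ → Set α} (hA : ∀ i, MeasurableSet (A i))
    (hd : Pairwise (Function.onFun Disjoint A)) (S : Finset ℕ) :
    indicatorConstLp p (S.measurableSet_biUnion fun i _ => hA i) (measure_ne_top μ _) (1 : ℝ) =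
      ∑ i ∈ S, indicatorConstLp p (hA i) (measure_ne_top μ _) (1 : ℝ) := by
  classical
  induction S using Finset.induction_on with
  | empty => simp
  | insert a S ha ih =>
    rw [Finset.sum_insert ha, ← ih, ← indicatorConstLp_disjoint_union]
    · congr 1
      simp
    · rw [Set.disjoint_iUnion₂_right]
      exact fun i hi => hd (by rintro rfl; exact ha hi)

variable [Fact (1 ≤ p)]

/-- The uncovered part of the union has measure at most a tail of the convergent series ∑ μ(A i),
and for p < ∞ small measure means small Lᵖ norm. This is the countable additivity of A ↦ φ(1_A). -/
theorem hasSum_indicatorConstLp (hp : p ≠ ⊤) {A : ℕ → Set α} (hA : ∀ i, MeasurableSet (A i))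
    (hd : Pairwise (Function.onFun Disjoint A)) :
    HasSum (fun i => indicatorConstLp p (hA i) (measure_ne_top μ _) (1 : ℝ))
      (indicatorConstLp p (MeasurableSet.iUnion hA) (measure_ne_top μ _) (1 : ℝ)) := by
  have h0 : Tendsto (fun S : Finset ℕ => μ (symmDiff (⋃ i ∈ S, A i) (⋃ i, A i))) atTop (𝓝 0) := by
    have h1 : ∑' i, μ (A i) ≠ ⊤ := by
      rw [← measure_iUnion hd hA]; exact measure_ne_top _ _
    refine tendsto_of_tendsto_of_tendsto_of_le_of_le tendsto_const_nhds
      (ENNReal.tendsto_tsum_compl_atTop_zero h1) (fun _ => zero_le) fun S => ?_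
    refine le_trans (measure_mono ?_) (measure_iUnion_le (fun b : {x // x ∉ S} => A b))
    rintro x (⟨hx, hx'⟩ | ⟨hx, hx'⟩)
    · simp only [Set.mem_iUnion, not_exists] at hx hx'
      obtain ⟨i, _, hi⟩ := hx
      exact absurd hi (hx' i)
    · simp only [Set.mem_iUnion, not_exists] at hx hx' ⊢
      obtain ⟨i, hi⟩ := hx
      exact ⟨⟨i, fun h => hx' i h hi⟩, hi⟩
  have h2 := tendsto_indicatorConstLp_set (p := p) (μ := μ) (c := (1 : ℝ))
    (hs := MeasurableSet.iUnion hA) (hμs := measure_ne_top _ _)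
    (ht := fun S : Finset ℕ => S.measurableSet_biUnion fun i _ => hA i)
    (hμt := fun S => measure_ne_top _ _) hp h0
  refine Tendsto.congr (fun S => ?_) h2
  exact indicatorConstLp_biUnion_finset hA hd S

/-- The signed measure `A ↦ φ(1_A)` defined by a functional `φ` on `Lᵖ`. -/
def dualSignedMeasure (hp : p ≠ ⊤) (φ : StrongDual ℝ (Lp ℝ p μ)) : SignedMeasure α where
  measureOf' A := by
    classical
    exact if hA : MeasurableSet A then φ (indicatorConstLp p hA (measure_ne_top μ _) 1) else 0
  empty' := by simp
  not_measurable' := by intro A hA; simp [hA]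
  m_iUnion' := by
    intro A hA hd
    simp only [hA, MeasurableSet.iUnion hA, dif_pos]
    exact φ.hasSum (hasSum_indicatorConstLp hp hA hd)

theorem dualSignedMeasure_apply (hp : p ≠ ⊤) (φ : StrongDual ℝ (Lp ℝ p μ)) {A : Set α}
    (hA : MeasurableSet A) :
    dualSignedMeasure hp φ A = φ (indicatorConstLp p hA (measure_ne_top μ _) 1) := by
  classical
  exact dif_pos hA

/-- Radon–Nikodym: the indicator of a null set is zero in Lᵖ, so A ↦ φ(1_A) is absolutely
continuous. -/
theorem exists_integrable_dual_indicator (hp : p ≠ ⊤) (φ : StrongDual ℝ (Lp ℝ p μ)) :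
    ∃ g : α → ℝ, Measurable g ∧ Integrable g μ ∧ ∀ (A : Set α) (hA : MeasurableSet A),
      φ (indicatorConstLp p hA (measure_ne_top μ _) 1) = ∫ x in A, g x ∂μ := by
  refine ⟨(dualSignedMeasure hp φ).rnDeriv μ, SignedMeasure.measurable_rnDeriv _ _,
    SignedMeasure.integrable_rnDeriv _ _, fun A hA => ?_⟩
  rw [← dualSignedMeasure_apply hp, ← withDensityᵥ_apply (SignedMeasure.integrable_rnDeriv _ _) hA,
    SignedMeasure.withDensityᵥ_rnDeriv_eq]
  refine VectorMeasure.AbsolutelyContinuous.mk fun s hs h0 => ?_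
  rw [Measure.toENNRealVectorMeasure_apply_measurable hs] at h0
  rw [dualSignedMeasure_apply hp φ hs]
  have : indicatorConstLp p hs (measure_ne_top μ _) (1 : ℝ) = 0 := by
    rw [Lp.eq_zero_iff_ae_eq_zero]
    refine indicatorConstLp_coeFn.trans ?_
    exact indicator_meas_zero h0
  rw [this, map_zero]

theorem dual_apply_simpleFunc {φ : StrongDual ℝ (Lp ℝ p μ)} {g : α → ℝ} (hg : Integrable g μ)
    (h : ∀ (A : Set α) (hA : MeasurableSet A),
      φ (indicatorConstLp p hA (measure_ne_top μ _) 1) = ∫ x in A, g x ∂μ) (f : SimpleFunc α ℝ) :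
    φ ((f.memLp_of_isFiniteMeasure p μ).toLp f) = ∫ x, f x * g x ∂μ := by
  have h_int : ∀ f : SimpleFunc α ℝ, Integrable (fun x => f x * g x) μ := by
    intro f
    obtain ⟨C, hC⟩ := f.exists_forall_norm_le
    exact hg.bdd_mul f.aestronglyMeasurable (ae_of_all _ hC)
  induction f using SimpleFunc.induction with
  | const c hs =>
    rename_i s
    have e1 : ((SimpleFunc.piecewise s hs (SimpleFunc.const α c)
        (SimpleFunc.const α 0)).memLp_of_isFiniteMeasure p μ).toLp _ =
        c • indicatorConstLp p hs (measure_ne_top μ _) (1 : ℝ) := by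
      rw [indicatorConstLp, ← MemLp.toLp_const_smul, MemLp.toLp_eq_toLp_iff]
      refine ae_of_all _ fun x => ?_
      by_cases hx : x ∈ s <;> simp [hx]
    rw [e1, map_smul, h s hs, ← integral_indicator hs, smul_eq_mul, ← integral_const_mul]
    congr 1
    ext x
    by_cases hx : x ∈ s <;> simp [hx]
  | add _ h1 h2 =>
    rename_i f1 f2 _
    have e1 : ((f1 + f2).memLp_of_isFiniteMeasure p μ).toLp _ =
        (f1.memLp_of_isFiniteMeasure p μ).toLp _ + (f2.memLp_of_isFiniteMeasure p μ).toLp _ := by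
      rw [← MemLp.toLp_add]; rfl
    rw [e1, map_add, h1, h2, ← integral_add (h_int _) (h_int _)]
    congr 1
    ext x
    simp [add_mul]

/-- Test φ with f = s^(Q-1) sgn g. Since (Q-1)P = Q, with I = ∫ s^Q this gives I ≤ ∫ f g = φ(f) ≤
‖φ‖ I^(1/P). Dividing is allowed because I is finite for a finite-valued simple s; this is why s
replaces |g|, whose integrability to the power Q is not yet known. -/
theorem lintegral_rpow_le_of_dual_apply {P Q : ℝ} (hPQ : P.HolderConjugate Q)
    (hP : p = ENNReal.ofReal P)
    {φ : StrongDual ℝ (Lp ℝ p μ)} {g : α → ℝ} (hgm : Measurable g) (hg : Integrable g μ)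
    (h : ∀ f : SimpleFunc α ℝ, φ ((f.memLp_of_isFiniteMeasure p μ).toLp f) = ∫ x, f x * g x ∂μ)
    (s : SimpleFunc α ℝ≥0∞) (hs : ∀ x, s x < ⊤) (hsg : ∀ x, s x ≤ ‖g x‖ₑ) :
    ∫⁻ x, s x ^ Q ∂μ ≤ ‖φ‖ₑ ^ Q := by
  set I := ∫⁻ x, s x ^ Q ∂μ with hI
  have hQ0 : 0 < Q := hPQ.symm.pos
  have hP0 : 0 < P := hPQ.pos
  let sgn : SimpleFunc α ℝ := SimpleFunc.piecewise {x | 0 ≤ g x} (measurableSet_le measurable_const hgm)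
    (SimpleFunc.const α 1) (SimpleFunc.const α (-1))
  let f : SimpleFunc α ℝ := s.map (fun t => t.toReal ^ (Q - 1)) * sgn
  have hsgn : ∀ x, sgn x * g x = |g x| := by
    intro x
    by_cases hx : 0 ≤ g x
    · simp [sgn, hx, abs_of_nonneg]
    · simp [sgn, hx, abs_of_neg (not_le.1 hx)]
  have hsgn' : ∀ x, |sgn x| = 1 := by
    intro x
    by_cases hx : 0 ≤ g x <;> simp [sgn, hx]
  have hfg : ∀ x, f x * g x = (s x).toReal ^ (Q - 1) * |g x| := by
    intro x
    rw [← hsgn]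
    simp [f, mul_assoc]
  have hfn : ∀ x, ‖f x‖ₑ = s x ^ (Q - 1) := by
    intro x
    have : |f x| = (s x).toReal ^ (Q - 1) := by
      simp only [f, SimpleFunc.coe_mul, Pi.mul_apply, abs_mul, hsgn', mul_one,
        SimpleFunc.coe_map, Function.comp_apply]
      exact abs_of_nonneg (Real.rpow_nonneg ENNReal.toReal_nonneg _)
    rw [← ofReal_norm, Real.norm_eq_abs, this,
      ← ENNReal.ofReal_rpow_of_nonneg ENNReal.toReal_nonneg hPQ.symm.sub_one_pos.le,
      ENNReal.ofReal_toReal (hs x).ne]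
  have hIfin : I ≠ ⊤ := by
    have : ∫⁻ x, (s.map (fun t => t ^ Q)) x ∂μ < ⊤ := by
      refine SimpleFunc.lintegral_eq_lintegral (s.map (fun t => t ^ Q)) μ ▸ ?_
      refine SimpleFunc.FinMeasSupp.lintegral_lt_top ?_ (ae_of_all _ fun x => ?_)
      · exact SimpleFunc.finMeasSupp_iff_support.2 (measure_lt_top _ _)
      · exact (ENNReal.rpow_lt_top_of_nonneg hQ0.le (hs x).ne).ne
    exact this.ne
  have hnorm : ‖(f.memLp_of_isFiniteMeasure p μ).toLp f‖ₑ = I ^ (1 / P) := by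
    rw [Lp.enorm_toLp, hP, eLpNorm_eq_lintegral_rpow_enorm_toReal (by simpa using hP0) (by simp),
      ENNReal.toReal_ofReal hP0.le]
    congr 1
    refine lintegral_congr fun x => ?_
    rw [hfn, ← ENNReal.rpow_mul, hPQ.symm.sub_one_mul_conj]
  have hle : I ≤ ‖φ‖ₑ * I ^ (1 / P) := by
    have h1 : I ≤ ENNReal.ofReal (∫ x, f x * g x ∂μ) := by
      rw [ofReal_integral_eq_lintegral_ofReal]
      · refine lintegral_mono fun x => ?_
        rw [hfg, ENNReal.ofReal_mul (Real.rpow_nonneg ENNReal.toReal_nonneg _),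
          ← ENNReal.ofReal_rpow_of_nonneg ENNReal.toReal_nonneg hPQ.symm.sub_one_pos.le,
          ENNReal.ofReal_toReal (hs x).ne, ← Real.norm_eq_abs, ofReal_norm]
        calc s x ^ Q = s x ^ (Q - 1) * s x := by
              conv_rhs => rw [← ENNReal.rpow_one (s x), ← ENNReal.rpow_mul, one_mul,
                ← ENNReal.rpow_add_of_nonneg _ _ hPQ.symm.sub_one_pos.le zero_le_one]
              congr 1; ring
          _ ≤ _ := by gcongr; exact hsg x
      · obtain ⟨C, hC⟩ := f.exists_forall_norm_le
        exact hg.bdd_mul f.aestronglyMeasurable (ae_of_all _ hC)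
      · refine ae_of_all _ fun x => ?_
        simp only [Pi.zero_apply]
        rw [hfg]
        positivity
    rw [← h f] at h1
    refine h1.trans ?_
    rw [← hnorm]
    refine le_trans ?_ (φ.le_opENorm _)
    exact Real.ofReal_le_enorm _
  by_cases hI0 : I = 0
  · rw [hI0]; exact zero_le
  have hI1 : I ^ (1 / Q) ≤ ‖φ‖ₑ := by
    have e : I = I ^ (1 / Q) * I ^ (1 / P) := by
      rw [← ENNReal.rpow_add _ _ hI0 hIfin, add_comm, one_div, one_div, hPQ.inv_add_inv_eq_one,
        ENNReal.rpow_one]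
    rw [e] at hle
    have h2 : (I ^ (1 / Q) * I ^ (1 / P)) ^ (1 / P) = I ^ (1 / P) := by rw [← e]
    rw [h2] at hle
    refine (ENNReal.mul_le_mul_iff_left ?_ ?_).1 hle
    · exact (ENNReal.rpow_pos (pos_iff_ne_zero.2 hI0) hIfin).ne'
    · exact ENNReal.rpow_ne_top_of_nonneg (by positivity) hIfin
  calc I = (I ^ (1 / Q)) ^ Q := by
        rw [← ENNReal.rpow_mul, one_div, inv_mul_cancel₀ hQ0.ne', ENNReal.rpow_one]
    _ ≤ _ := ENNReal.rpow_le_rpow hI1 hQ0.le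

/-- Functionals on `Lᵖ` over a finite measure are represented by functions in `L^q`. -/
theorem exists_memLp_dual {P Q : ℝ} (hPQ : P.HolderConjugate Q) (hP : p = ENNReal.ofReal P)
    (φ : StrongDual ℝ (Lp ℝ p μ)) :
    ∃ g : α → ℝ, MemLp g (ENNReal.ofReal Q) μ ∧ ∀ f : Lp ℝ p μ, φ f = ∫ x, g x * f x ∂μ := by
  have hp : p ≠ ⊤ := by rw [hP]; simp
  obtain ⟨g, hgm, hg, hgφ⟩ := exists_integrable_dual_indicator hp φ
  have hφs := dual_apply_simpleFunc hg hgφ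
  have hQ0 : 0 < Q := hPQ.symm.pos
  -- Monotone convergence along simple functions increasing to |g| gives ∫ |g|^Q ≤ ‖φ‖^Q.
  have hgQ : MemLp g (ENNReal.ofReal Q) μ := by
    refine ⟨hgm.aestronglyMeasurable, ?_⟩
    rw [eLpNorm_lt_top_iff_lintegral_rpow_enorm_lt_top (by simpa using hQ0) (by simp),
      ENNReal.toReal_ofReal hQ0.le]
    have hm : Measurable fun x => ‖g x‖ₑ := hgm.enorm
    have e : ∀ x, ‖g x‖ₑ ^ Q = ⨆ n, (SimpleFunc.eapprox (fun x => ‖g x‖ₑ) n) x ^ Q := by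
      intro x
      rw [← SimpleFunc.iSup_eapprox_apply hm x]
      exact (ENNReal.monotone_rpow_of_nonneg hQ0.le).map_iSup_of_continuousAt
        ENNReal.continuous_rpow_const.continuousAt (by simp [hQ0])
    simp_rw [e]
    rw [lintegral_iSup]
    · refine lt_of_le_of_lt (iSup_le fun n => ?_) (b := ‖φ‖ₑ ^ Q)
        (ENNReal.rpow_lt_top_of_nonneg hQ0.le (by simp))
      refine lintegral_rpow_le_of_dual_apply hPQ hP hgm hg hφs _
        (fun x => SimpleFunc.eapprox_lt_top _ _ _) fun x => ?_
      rw [← SimpleFunc.iSup_eapprox_apply hm x]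
      exact le_iSup (fun n => (SimpleFunc.eapprox (fun x => ‖g x‖ₑ) n) x) n
    · intro n
      exact (SimpleFunc.measurable _).pow_const _
    · intro m n hmn x
      exact ENNReal.rpow_le_rpow (SimpleFunc.monotone_eapprox _ hmn x) hQ0.le
  refine ⟨g, hgQ, ?_⟩
  have : Fact (1 ≤ ENNReal.ofReal Q) := ⟨by simpa using hPQ.symm.lt.le⟩
  have : (ENNReal.ofReal Q).HolderConjugate p := by
    rw [hP]; exact hPQ.symm.ennrealOfReal
  let ψ : StrongDual ℝ (Lp ℝ p μ) :=
    (ContinuousLinearMap.mul ℝ ℝ).lpPairing μ (ENNReal.ofReal Q) p (hgQ.toLp g)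
  have hψ : ∀ f, ψ f = ∫ x, g x * f x ∂μ := by
    intro f
    simp only [ψ]
    rw [ContinuousLinearMap.lpPairing_eq_integral]
    refine integral_congr_ae ?_
    filter_upwards [hgQ.coeFn_toLp] with x hx
    simp [hx]
  -- Both sides are continuous and agree on the dense set of simple functions.
  have hφψ : φ = ψ := by
    refine ContinuousLinearMap.ext fun f => ?_
    refine (Lp.simpleFunc.denseRange (p := p) (μ := μ) (E := ℝ) hp).induction_on f
      (isClosed_eq φ.continuous ψ.continuous) fun s => ?_
    rw [hψ, ← Lp.simpleFunc.toLp_toSimpleFunc s]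
    have h1 := hφs (Lp.simpleFunc.toSimpleFunc s)
    refine h1.trans ?_
    refine integral_congr_ae ?_
    filter_upwards [MemLp.coeFn_toLp (Lp.simpleFunc.memLp s)] with x hx
    rw [mul_comm]
    congr 1
    exact hx.symm
  intro f
  rw [hφψ, hψ]

/-- `Lᵖ` over a finite measure is reflexive for `1 < p < ∞`. -/
theorem isReflexiveSpace_Lp (hp₁ : 1 < p) (hp₂ : p ≠ ⊤) : IsReflexiveSpace (Lp ℝ p μ) := by
  have hP1 : 1 < p.toReal := by
    rwa [← ENNReal.ofReal_lt_ofReal_iff_of_nonneg zero_le_one, ENNReal.ofReal_toReal hp₂,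
      ENNReal.ofReal_one]
  have hPQ : p.toReal.HolderConjugate (Real.conjExponent p.toReal) :=
    Real.HolderConjugate.conjExponent hP1
  set Q := Real.conjExponent p.toReal
  have hP : p = ENNReal.ofReal p.toReal := (ENNReal.ofReal_toReal hp₂).symm
  have : Fact (1 ≤ ENNReal.ofReal Q) := ⟨by simpa using hPQ.symm.lt.le⟩
  have : (ENNReal.ofReal Q).HolderConjugate p := by
    have := hPQ.symm.ennrealOfReal
    rwa [← hP] at this
  let ι : Lp ℝ (ENNReal.ofReal Q) μ →L[ℝ] StrongDual ℝ (Lp ℝ p μ) :=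
    (ContinuousLinearMap.mul ℝ ℝ).lpPairing μ (ENNReal.ofReal Q) p
  have hι : ∀ g f, ι g f = ∫ x, g x * f x ∂μ := fun g f =>
    (ContinuousLinearMap.mul ℝ ℝ).lpPairing_eq_integral g f
  rw [isReflexiveSpace_iff]
  intro Φ
  -- Pulled back along L^Q → (Lᵖ)*, Φ becomes a functional on L^Q, represented by some f in Lᵖ. As
  -- that map is onto, f represents Φ itself.
  obtain ⟨f, hf, hΦ⟩ := exists_memLp_dual hPQ.symm rfl (Φ ∘L ι)
  rw [← hP] at hf
  refine ⟨hf.toLp f, fun φ => ?_⟩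
  obtain ⟨g, hg, hφ⟩ := exists_memLp_dual hPQ hP φ
  have e : φ = ι (hg.toLp g) := by
    ext u
    rw [hφ, hι]
    refine integral_congr_ae ?_
    filter_upwards [hg.coeFn_toLp] with x hx
    rw [hx]
  rw [e]
  refine (hΦ _).trans ?_
  rw [hι]
  refine integral_congr_ae ?_
  filter_upwards [hf.coeFn_toLp] with x hx
  rw [hx, mul_comm]

end LpDual

/-! ### Translation estimates for Sobolev functions. -/

section Translation

variable {N : ℕ} {p : ℝ≥0∞} {Ω : Set (Eucl N)} {u : Eucl N → ℝ} {g : Eucl N → Eucl N}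

/-- The mollification of (the extension by zero of) `u`. -/
def mollify (Ω : Set (Eucl N)) (ρ : ContDiffBump (0 : Eucl N)) (u : Eucl N → ℝ) : Eucl N → ℝ :=
  convolution (ρ.normed volume) (Ω.indicator u) (ContinuousLinearMap.lsmul ℝ ℝ) volume

theorem locallyIntegrable_indicator (hΩ : MeasurableSet Ω) (hp : 1 ≤ p) (hu : MemLp u p (leb Ω)) :
    LocallyIntegrable (Ω.indicator u) volume :=
  ((memLp_indicator_iff_restrict hΩ).2 hu).locallyIntegrable hp

theorem contDiff_mollify (hΩ : MeasurableSet Ω) (hp : 1 ≤ p) (hu : MemLp u p (leb Ω))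
    (ρ : ContDiffBump (0 : Eucl N)) : ContDiff ℝ 1 (mollify Ω ρ u) := by
  have := ρ.hasCompactSupport_normed (μ := volume).contDiff_convolution_left (n := 1)
    (ContinuousLinearMap.lsmul ℝ ℝ) ρ.contDiff_normed (locallyIntegrable_indicator hΩ hp hu)
  exact this

/-- The derivative can be put on the bump, and y ↦ ρ(x - y) is an admissible test function as soon
as its supporting ball lies in Ω. -/
theorem fderiv_mollify (hΩ : MeasurableSet Ω) (hp : 1 ≤ p) (hu : MemLp u p (leb Ω))
    (hw : IsWeakGradient Ω u g) (ρ : ContDiffBump (0 : Eucl N)) {x : Eucl N}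
    (hx : Metric.closedBall x ρ.rOut ⊆ Ω) (h : Eucl N) :
    fderiv ℝ (mollify Ω ρ u) x h = ∫ y in Ω, ρ.normed volume (x - y) * inner ℝ (g y) h := by
  have hloc := locallyIntegrable_indicator hΩ hp hu
  have hd := ρ.hasCompactSupport_normed (μ := volume).hasFDerivAt_convolution_left
    (ContinuousLinearMap.lsmul ℝ ℝ) (ρ.contDiff_normed (n := 1)) hloc x
  have hex : ConvolutionExistsAt (fderiv ℝ (ρ.normed volume)) (Ω.indicator u) x
      (ContinuousLinearMap.precompL (Eucl N) (ContinuousLinearMap.lsmul ℝ ℝ)) volume :=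
    (ρ.hasCompactSupport_normed.fderiv ℝ).convolutionExists_left _
      ((ρ.contDiff_normed (n := 1)).continuous_fderiv (by simp)) hloc x
  set φ : Eucl N → ℝ := fun y => ρ.normed volume (x - y) with hφ
  have hφd : ∀ y, fderiv ℝ φ y h = - fderiv ℝ (ρ.normed volume) (x - y) h := by
    intro y
    have h1 : HasFDerivAt (ρ.normed volume) (fderiv ℝ (ρ.normed volume) (x - y)) (x - y) :=
      ((ρ.contDiff_normed (n := 1)).differentiable (by simp) _).hasFDerivAt
    have h2 : HasFDerivAt (fun y : Eucl N => x - y) (-ContinuousLinearMap.id ℝ (Eucl N)) y :=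
      (hasFDerivAt_id y).const_sub x
    have h3 : HasFDerivAt φ _ y := h1.comp y h2
    rw [h3.fderiv]
    simp
  have hφs : ContDiff ℝ (⊤ : ℕ∞) φ := ρ.contDiff_normed.comp (contDiff_const.sub contDiff_id)
  have hsupp : Function.support φ ⊆ Metric.closedBall x ρ.rOut := by
    intro y hy
    have : x - y ∈ Function.support (ρ.normed volume) := hy
    rw [ρ.support_normed_eq] at this
    rw [Metric.mem_closedBall, dist_comm, dist_eq_norm]
    simpa using (mem_ball_zero_iff.1 this).le
  have hts : tsupport φ ⊆ Metric.closedBall x ρ.rOut :=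
    closure_minimal hsupp Metric.isClosed_closedBall
  have hφc : HasCompactSupport φ := (isCompact_closedBall x ρ.rOut).of_isClosed_subset
    (isClosed_tsupport _) hts
  have key := hw φ hφs hφc (hts.trans hx) h
  rw [mollify, hd.fderiv, convolution_def, ContinuousLinearMap.integral_apply hex]
  simp only [ContinuousLinearMap.precompL_apply, ContinuousLinearMap.lsmul_apply, smul_eq_mul]
  rw [← integral_sub_left_eq_self _ volume x]
  simp only [sub_sub_cancel]
  rw [← neg_eq_iff_eq_neg] at key
  rw [← key, ← integral_neg, ← integral_indicator hΩ]
  congr 1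
  ext y
  by_cases hy : y ∈ Ω
  · simp [hy, hφd]
  · simp [hy]

/-- Fundamental theorem of calculus along the segment from x to x + h, a neighbourhood of which
stays in Ω. -/
theorem enorm_mollify_sub_le (hΩ : MeasurableSet Ω) (hp : 1 ≤ p) (hu : MemLp u p (leb Ω))
    (hw : IsWeakGradient Ω u g) (ρ : ContDiffBump (0 : Eucl N)) {x h : Eucl N}
    (hx : ∀ t ∈ Set.Icc (0 : ℝ) 1, Metric.closedBall (x + t • h) ρ.rOut ⊆ Ω) :
    ‖mollify Ω ρ u (x + h) - mollify Ω ρ u x‖ₑ ≤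
      ‖h‖ₑ * ∫⁻ t in Set.Icc (0 : ℝ) 1, ∫⁻ z, ENNReal.ofReal (ρ.normed volume z) *
        Ω.indicator (fun y => ‖g y‖ₑ) (x + t • h - z) := by
  have hC := contDiff_mollify hΩ hp hu ρ
  have hline : ∀ t : ℝ, HasDerivAt (fun t : ℝ => x + t • h) h t := fun t => by
    simpa using ((hasDerivAt_id t).smul_const h).const_add x
  have hder : ∀ t : ℝ, HasDerivAt (fun t : ℝ => mollify Ω ρ u (x + t • h))
      (fderiv ℝ (mollify Ω ρ u) (x + t • h) h) t := fun t =>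
    ((hC.differentiable (by simp) _).hasFDerivAt).comp_hasDerivAt t (hline t)
  have hcont : Continuous fun t : ℝ => fderiv ℝ (mollify Ω ρ u) (x + t • h) h :=
    ((hC.continuous_fderiv (by simp)).comp (by fun_prop)).clm_apply continuous_const
  have hFTC := intervalIntegral.integral_eq_sub_of_hasDerivAt (a := 0) (b := 1)
    (fun t _ => hder t) (hcont.intervalIntegrable 0 1)
  simp only [one_smul, zero_smul, add_zero] at hFTC
  rw [← hFTC, intervalIntegral.integral_of_le zero_le_one, ← integral_Icc_eq_integral_Ioc]
  refine (enorm_integral_le_lintegral_enorm _).trans ?_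
  rw [← lintegral_const_mul' _ _ (by simp)]
  refine setLIntegral_mono' measurableSet_Icc fun t ht => ?_
  rw [fderiv_mollify hΩ hp hu hw ρ (hx t ht)]
  refine (enorm_integral_le_lintegral_enorm _).trans ?_
  rw [← lintegral_const_mul' _ _ (by simp), ← lintegral_indicator hΩ,
    ← lintegral_sub_left_eq_self (μ := volume) (fun z => ‖h‖ₑ *
      (ENNReal.ofReal (ρ.normed volume z) * _)) (x + t • h)]
  refine lintegral_mono fun y => ?_
  by_cases hy : y ∈ Ω
  · simp only [hy, Set.indicator_of_mem, sub_sub_cancel]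
    rw [enorm_mul, Real.enorm_of_nonneg (ρ.nonneg_normed _), mul_left_comm]
    gcongr
    rw [mul_comm]
    simpa only [ofReal_norm, ENNReal.ofReal_mul (norm_nonneg _)] using
      ENNReal.ofReal_le_ofReal (norm_inner_le_norm (𝕜 := ℝ) (g y) h)
  · simp [hy]

/-- Jensen's inequality for t ↦ t^P, read off from the monotonicity of Lᵖ norms on a probability
space. -/
theorem lintegral_rpow_le_of_isProbabilityMeasure {α : Type*} [MeasurableSpace α] {μ : Measure α}
    [IsProbabilityMeasure μ] {P : ℝ} (hP : 1 ≤ P) {f : α → ℝ≥0∞} (hf : AEMeasurable f μ) :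
    (∫⁻ x, f x ∂μ) ^ P ≤ ∫⁻ x, f x ^ P ∂μ := by
  have hP0 : 0 < P := by linarith
  have h := eLpNorm_le_eLpNorm_of_exponent_le (μ := μ) (p := 1) (q := ENNReal.ofReal P) (f := f)
    (by simpa using hP) hf.aestronglyMeasurable
  rw [eLpNorm_one_eq_lintegral_enorm, eLpNorm_eq_lintegral_rpow_enorm_toReal (by simpa using hP0)
    (by simp), ENNReal.toReal_ofReal hP0.le] at h
  simp only [enorm_eq_self] at h
  calc _ ≤ ((∫⁻ x, f x ^ P ∂μ) ^ (1 / P)) ^ P := ENNReal.rpow_le_rpow h hP0.le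
    _ = _ := by rw [← ENNReal.rpow_mul, one_div, inv_mul_cancel₀ hP0.ne', ENNReal.rpow_one]

/-- Jensen for the probability measure dt ⊗ ρ(z)dz on [0,1] × ℝᴺ, then Tonelli: by translation
invariance the integral over x no longer depends on (t, z). The bound is independent of ρ. -/
theorem lintegral_mollify_sub_le (hΩ : MeasurableSet Ω) (hp : 1 ≤ p) (hu : MemLp u p (leb Ω))
    (hg : Measurable g) (hw : IsWeakGradient Ω u g) {P : ℝ} (hP : 1 ≤ P)
    (ρ : ContDiffBump (0 : Eucl N)) {h : Eucl N} {S : Set (Eucl N)} (hS : MeasurableSet S)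
    (hx : ∀ x ∈ S, ∀ t ∈ Set.Icc (0 : ℝ) 1, Metric.closedBall (x + t • h) ρ.rOut ⊆ Ω) :
    ∫⁻ x in S, ‖mollify Ω ρ u (x + h) - mollify Ω ρ u x‖ₑ ^ P ≤
      ‖h‖ₑ ^ P * ∫⁻ x in Ω, ‖g x‖ₑ ^ P := by
  have hP0 : 0 < P := by linarith
  set k : Eucl N → ℝ≥0∞ := Ω.indicator (fun y => ‖g y‖ₑ) with hk
  have hkm : Measurable k := hg.enorm.indicator hΩ
  let ν : Measure (Eucl N) := volume.withDensity fun z => ENNReal.ofReal (ρ.normed volume z)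
  have hρm : Measurable fun z => ENNReal.ofReal (ρ.normed volume z) :=
    (ρ.continuous_normed.measurable).ennreal_ofReal
  have : IsProbabilityMeasure ν := by
    refine ⟨?_⟩
    rw [withDensity_apply _ MeasurableSet.univ, Measure.restrict_univ,
      ← ofReal_integral_eq_lintegral_ofReal ρ.integrable_normed (ae_of_all _ ρ.nonneg_normed),
      ρ.integral_normed, ENNReal.ofReal_one]
  have : IsProbabilityMeasure (volume.restrict (Set.Icc (0 : ℝ) 1)) := ⟨by simp⟩
  let τ := (volume.restrict (Set.Icc (0 : ℝ) 1)).prod ν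
  have hkm' : Measurable fun q : Eucl N × (ℝ × Eucl N) => k (q.1 + q.2.1 • h - q.2.2) :=
    hkm.comp (by fun_prop)
  have hpt : ∀ x ∈ S, ‖mollify Ω ρ u (x + h) - mollify Ω ρ u x‖ₑ ^ P ≤
      ‖h‖ₑ ^ P * ∫⁻ q, k (x + q.1 • h - q.2) ^ P ∂τ := by
    intro x hxS
    have h1 := enorm_mollify_sub_le hΩ hp hu hw ρ (hx x hxS)
    have hkx : Measurable fun q : ℝ × Eucl N => k (x + q.1 • h - q.2) :=
      hkm.comp (by fun_prop)
    have h2 : ∫⁻ t in Set.Icc (0 : ℝ) 1, ∫⁻ z, ENNReal.ofReal (ρ.normed volume z) *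
        k (x + t • h - z) = ∫⁻ q, k (x + q.1 • h - q.2) ∂τ := by
      rw [lintegral_prod _ hkx.aemeasurable]
      refine lintegral_congr fun t => ?_
      have hkt : Measurable fun z : Eucl N => k (x + t • h - z) := hkm.comp (by fun_prop)
      simp only [ν]
      rw [lintegral_withDensity_eq_lintegral_mul _ hρm hkt]
      rfl
    rw [h2] at h1
    calc _ ≤ (‖h‖ₑ * ∫⁻ q, k (x + q.1 • h - q.2) ∂τ) ^ P := ENNReal.rpow_le_rpow h1 hP0.le
      _ = ‖h‖ₑ ^ P * (∫⁻ q, k (x + q.1 • h - q.2) ∂τ) ^ P := ENNReal.mul_rpow_of_nonneg _ _ hP0.le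
      _ ≤ _ := by
        gcongr
        exact lintegral_rpow_le_of_isProbabilityMeasure hP hkx.aemeasurable
  calc _ ≤ ∫⁻ x in S, ‖h‖ₑ ^ P * ∫⁻ q, k (x + q.1 • h - q.2) ^ P ∂τ :=
        setLIntegral_mono' hS hpt
    _ = ‖h‖ₑ ^ P * ∫⁻ x in S, ∫⁻ q, k (x + q.1 • h - q.2) ^ P ∂τ := by
        rw [lintegral_const_mul' _ _ (ENNReal.rpow_ne_top_of_nonneg hP0.le (by simp))]
    _ ≤ ‖h‖ₑ ^ P * ∫⁻ x, ∫⁻ q, k (x + q.1 • h - q.2) ^ P ∂τ := by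
        gcongr
        exact Measure.restrict_le_self
    _ = ‖h‖ₑ ^ P * ∫⁻ q, (∫⁻ x, k (x + q.1 • h - q.2) ^ P) ∂τ := by
        rw [lintegral_lintegral_swap]
        exact (hkm'.pow_const P).aemeasurable
    _ = ‖h‖ₑ ^ P * ∫⁻ q, (∫⁻ x, k x ^ P) ∂τ := by
        congr 1
        refine lintegral_congr fun q => ?_
        simp_rw [add_sub_assoc]
        exact lintegral_add_right_eq_self (fun x => k x ^ P) _
    _ = _ := by
        rw [lintegral_const, measure_univ, mul_one, ← lintegral_indicator hΩ]
        congr 1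
        refine lintegral_congr fun x => ?_
        by_cases hy : x ∈ Ω <;> simp [hk, hy, hP0]

/-- Translations of Sobolev functions are controlled by the weak gradient. -/
theorem lintegral_translate_sub_le (hΩ : IsOpen Ω) (hp : 1 ≤ p) (hu : MemLp u p (leb Ω))
    (hg : AEStronglyMeasurable g (leb Ω)) (hw : IsWeakGradient Ω u g) {P : ℝ} (hP : 1 ≤ P)
    {h : Eucl N} {A : Set (Eucl N)} (hA : MeasurableSet A)
    (hAh : ∀ x ∈ A, ∀ t ∈ Set.Icc (0 : ℝ) 1, x + t • h ∈ Ω) :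
    ∫⁻ x in A, ‖u (x + h) - u x‖ₑ ^ P ≤ ‖h‖ₑ ^ P * ∫⁻ x in Ω, ‖g x‖ₑ ^ P := by
  have hP0 : 0 < P := by linarith
  have hw' : IsWeakGradient Ω u (hg.mk g) := by
    intro φ h1 h2 h3 y
    rw [hw φ h1 h2 h3 y]
    congr 1
    refine integral_congr_ae ?_
    filter_upwards [hg.ae_eq_mk] with x hx
    rw [hx]
  have e1 : ∫⁻ x in Ω, ‖g x‖ₑ ^ P = ∫⁻ x in Ω, ‖hg.mk g x‖ₑ ^ P := by
    refine lintegral_congr_ae ?_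
    filter_upwards [hg.ae_eq_mk] with x hx
    rw [hx]
  rw [e1]
  let ρ : ℕ → ContDiffBump (0 : Eucl N) := fun n =>
    ⟨1 / (n + 1 : ℝ) / 2, 1 / (n + 1 : ℝ), by positivity, by
      have : 0 < 1 / (n + 1 : ℝ) := by positivity
      linarith⟩
  have hρ0 : Tendsto (fun n => (ρ n).rOut) atTop (𝓝 0) := tendsto_one_div_add_atTop_nhds_zero_nat
  -- The ratio of outer to inner radius is 2 for all n; this bound ensures a.e. convergence of the
  -- mollifications.
  have hconv := ContDiffBump.ae_convolution_tendsto_right_of_locallyIntegrable (μ := volume)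
    (K := 2) hρ0 (Eventually.of_forall fun n => by simp only [ρ]; linarith)
    (locallyIntegrable_indicator hΩ.measurableSet hp hu)
  have hconv' : ∀ᵐ x : Eucl N, Tendsto (fun n => mollify Ω (ρ n) u (x + h)) atTop
      (𝓝 (Ω.indicator u (x + h))) :=
    (measurePreserving_add_right volume h).quasiMeasurePreserving.ae hconv
  -- Points whose segment keeps distance 2 `rOut` from the complement. The factor 2 gives room for a
  -- closed condition; the extended distance also covers an empty complement.
  let S : ℕ → Set (Eucl N) := fun n => ⋂ t ∈ Set.Icc (0 : ℝ) 1,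
    {x | ENNReal.ofReal (2 * (ρ n).rOut) ≤ Metric.infEDist (x + t • h) Ωᶜ}
  have hSm : ∀ n, MeasurableSet (S n) := fun n => by
    refine IsClosed.measurableSet (isClosed_biInter fun t _ => ?_)
    exact isClosed_le continuous_const (Metric.continuous_infEDist.comp (by fun_prop))
  have hSball : ∀ n, ∀ x ∈ S n, ∀ t ∈ Set.Icc (0 : ℝ) 1,
      Metric.closedBall (x + t • h) (ρ n).rOut ⊆ Ω := by
    intro n x hx t ht y hy
    by_contra hyΩ
    have h1 : ENNReal.ofReal (2 * (ρ n).rOut) ≤ Metric.infEDist (x + t • h) Ωᶜ := by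
      simpa using Set.mem_iInter₂.1 hx t ht
    have h2 : Metric.infEDist (x + t • h) Ωᶜ ≤ edist (x + t • h) y :=
      Metric.infEDist_le_edist_of_mem hyΩ
    have h3 : edist (x + t • h) y ≤ ENNReal.ofReal (ρ n).rOut := by
      rw [edist_dist, dist_comm]
      exact ENNReal.ofReal_le_ofReal hy
    have h4 := (ENNReal.ofReal_le_ofReal_iff (ρ n).rOut_pos.le).1 (h1.trans (h2.trans h3))
    have := (ρ n).rOut_pos
    linarith
  -- The segment is compact and Ω is open, so its distance from the complement is attained and
  -- positive.
  have hev : ∀ x ∈ A, ∀ᶠ n in atTop, x ∈ S n := by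
    intro x hx
    obtain ⟨t₀, ht₀, hmin⟩ := (isCompact_Icc (a := (0 : ℝ)) (b := 1)).exists_isMinOn
      ⟨0, by simp⟩ (f := fun t => Metric.infEDist (x + t • h) Ωᶜ)
      (Metric.continuous_infEDist.comp (by fun_prop)).continuousOn
    have hpos : 0 < Metric.infEDist (x + t₀ • h) Ωᶜ := by
      rw [Metric.infEDist_pos_iff_notMem_closure, hΩ.isClosed_compl.closure_eq]
      simpa using hAh x hx t₀ ht₀
    have h0 : Tendsto (fun n => ENNReal.ofReal (2 * (ρ n).rOut)) atTop (𝓝 0) := by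
      have := ENNReal.tendsto_ofReal (hρ0.const_mul 2)
      simpa using this
    filter_upwards [h0.eventually (gt_mem_nhds hpos)] with n hn
    refine Set.mem_iInter₂.2 fun t ht => ?_
    exact hn.le.trans (hmin ht)
  let f : ℕ → Eucl N → ℝ≥0∞ := fun n => (S n).indicator fun x =>
    ‖mollify Ω (ρ n) u (x + h) - mollify Ω (ρ n) u x‖ₑ ^ P
  have hfm : ∀ n, AEMeasurable (f n) (volume.restrict A) := fun n => by
    have hc : Continuous (mollify Ω (ρ n) u) :=
      (contDiff_mollify hΩ.measurableSet hp hu (ρ n)).continuous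
    have h1 : Continuous fun x => mollify Ω (ρ n) u (x + h) - mollify Ω (ρ n) u x := by fun_prop
    exact ((h1.measurable.enorm.pow_const P).indicator (hSm n)).aemeasurable
  calc ∫⁻ x in A, ‖u (x + h) - u x‖ₑ ^ P ≤ ∫⁻ x in A, liminf (fun n => f n x) atTop := by
        refine lintegral_mono_ae ?_
        filter_upwards [ae_restrict_of_ae hconv, ae_restrict_of_ae hconv', ae_restrict_mem hA]
          with x h1 h2 hxA
        have hxΩ : x ∈ Ω := by simpa using hAh x hxA 0 (by simp)
        have hxΩ' : x + h ∈ Ω := by simpa using hAh x hxA 1 (by simp)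
        rw [Set.indicator_of_mem hxΩ] at h1
        rw [Set.indicator_of_mem hxΩ'] at h2
        have h3 : Tendsto (fun n => ‖mollify Ω (ρ n) u (x + h) - mollify Ω (ρ n) u x‖ₑ ^ P) atTop
            (𝓝 (‖u (x + h) - u x‖ₑ ^ P)) :=
          (ENNReal.continuous_rpow_const.tendsto _).comp
            ((continuous_enorm.tendsto _).comp (h2.sub h1))
        have h4 : Tendsto (fun n => f n x) atTop (𝓝 (‖u (x + h) - u x‖ₑ ^ P)) := by
          refine h3.congr' ?_
          filter_upwards [hev x hxA] with n hn
          simp only [f]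
          rw [Set.indicator_of_mem hn]
        exact h4.liminf_eq.ge
    -- Fatou's lemma; each term on the right obeys the bound for smooth mollifications.
    _ ≤ liminf (fun n => ∫⁻ x in A, f n x) atTop := lintegral_liminf_le' hfm
    _ ≤ _ := by
        refine liminf_le_of_le (by isBoundedDefault) fun b hb => ?_
        obtain ⟨n, hn⟩ := hb.exists
        refine hn.trans ?_
        calc ∫⁻ x in A, f n x ≤ ∫⁻ x, f n x := setLIntegral_le_lintegral _ _
          _ = _ := lintegral_indicator (hSm n) _
          _ ≤ _ := lintegral_mollify_sub_le hΩ.measurableSet hp hu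
            hg.stronglyMeasurable_mk.measurable hw' hP (ρ n) (hSm n) (hSball n)

end Translation

/-! ### Poincaré inequality: balls, boundary charts, gluing. -/

section Poincare

variable {N : ℕ} {p : ℝ≥0∞} {Ω U V A : Set (Eucl N)}

/-- On `U ⊆ Ω`, Sobolev functions on `Ω` are constant up to an error controlled by the gradient. -/
def IsPoincareSet (p : ℝ≥0∞) (Ω U : Set (Eucl N)) : Prop :=
  ∃ C : ℝ≥0∞, C ≠ ⊤ ∧ ∀ (u : Eucl N → ℝ) (g : Eucl N → Eucl N), Measurable u →
    MemLp u p (leb Ω) → AEStronglyMeasurable g (leb Ω) → IsWeakGradient Ω u g →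
      ∃ c : ℝ, eLpNorm (fun x => u x - c) p (leb U) ≤ C * eLpNorm g p (leb Ω)

theorem eLpNorm_translate_sub_le (hΩ : IsOpen Ω) (hp : 1 ≤ p) (hp' : p ≠ ⊤) {u : Eucl N → ℝ}
    {g : Eucl N → Eucl N} (hu : MemLp u p (leb Ω)) (hg : AEStronglyMeasurable g (leb Ω))
    (hw : IsWeakGradient Ω u g) {h : Eucl N} (hA : MeasurableSet A)
    (hAh : ∀ x ∈ A, ∀ t ∈ Set.Icc (0 : ℝ) 1, x + t • h ∈ Ω) :
    eLpNorm (fun x => u (x + h) - u x) p (leb A) ≤ ‖h‖ₑ * eLpNorm g p (leb Ω) := by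
  have hp0 : p ≠ 0 := (zero_lt_one.trans_le hp).ne'
  have hP : 1 ≤ p.toReal := by
    simpa using ENNReal.toReal_mono hp' hp
  have hP0 : 0 < p.toReal := by linarith
  have key := lintegral_translate_sub_le hΩ hp hu hg hw hP hA hAh
  rw [eLpNorm_eq_lintegral_rpow_enorm_toReal hp0 hp', eLpNorm_eq_lintegral_rpow_enorm_toReal hp0 hp']
  calc _ ≤ (‖h‖ₑ ^ p.toReal * ∫⁻ x in Ω, ‖g x‖ₑ ^ p.toReal) ^ (1 / p.toReal) :=
        ENNReal.rpow_le_rpow key (by positivity)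
    _ = _ := by
        rw [ENNReal.mul_rpow_of_nonneg _ _ (by positivity), ← ENNReal.rpow_mul, mul_one_div,
          div_self hP0.ne', ENNReal.rpow_one]

/-- The constant found for u on U also serves on A: u(x) - c differs from u(x + h) - c by a
translation difference, which the gradient controls. -/
theorem isPoincareSet_of_translate (hΩ : IsOpen Ω) (hp : 1 ≤ p) (hp' : p ≠ ⊤)
    (hU : IsPoincareSet p Ω U) (hUm : MeasurableSet U) {h : Eucl N} (hA : MeasurableSet A)
    (hAh : ∀ x ∈ A, ∀ t ∈ Set.Icc (0 : ℝ) 1, x + t • h ∈ Ω) (hAU : ∀ x ∈ A, x + h ∈ U) :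
    IsPoincareSet p Ω A := by
  obtain ⟨C, hC, hCU⟩ := hU
  refine ⟨‖h‖ₑ + C, by simp [hC], fun u g hum hu hg hw => ?_⟩
  obtain ⟨c, hc⟩ := hCU u g hum hu hg hw
  refine ⟨c, ?_⟩
  have hum' : Measurable fun x => u (x + h) := hum.comp (measurable_add_const h)
  have e : (fun x => u x - c) = (fun x => u (x + h) - c) - fun x => u (x + h) - u x := by
    ext x; simp
  have h1 : eLpNorm (fun x => u (x + h) - c) p (leb A) ≤ eLpNorm (fun x => u x - c) p (leb U) := by
    rw [← eLpNorm_comp_measurePreserving (hum.sub_const c).aestronglyMeasurable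
      ((measurePreserving_add_right volume h).restrict_preimage hUm)]
    exact eLpNorm_mono_measure _ (Measure.restrict_mono hAU le_rfl)
  calc _ ≤ eLpNorm (fun x => u (x + h) - c) p (leb A) +
        eLpNorm (fun x => u (x + h) - u x) p (leb A) := by
        rw [e]
        exact eLpNorm_sub_le (hum'.sub_const c).aestronglyMeasurable
          (hum'.sub hum).aestronglyMeasurable hp
    _ ≤ C * eLpNorm g p (leb Ω) + ‖h‖ₑ * eLpNorm g p (leb Ω) :=
        add_le_add (h1.trans hc) (eLpNorm_translate_sub_le hΩ hp hp' hu hg hw hA hAh)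
    _ = _ := by ring

/-- Integrate |u(x) - u(y)|^P over B × B. Writing x = y + h with |h| < 2r, Tonelli reduces this to
the translation estimate; the segments stay in the ball of radius 3r. -/
theorem isPoincareSet_ball (hΩ : IsOpen Ω) (hp : 1 ≤ p) (hp' : p ≠ ⊤) {x₀ : Eucl N} {r : ℝ}
    (hr : 0 < r) (hB : Metric.ball x₀ (3 * r) ⊆ Ω) : IsPoincareSet p Ω (Metric.ball x₀ r) := by
  have hp0 : p ≠ 0 := (zero_lt_one.trans_le hp).ne'
  have hP : 1 ≤ p.toReal := by
    simpa using ENNReal.toReal_mono hp' hp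
  have hP0 : 0 < p.toReal := by linarith
  set P := p.toReal with hPdef
  set B := Metric.ball x₀ r with hBdef
  have hBm : MeasurableSet B := measurableSet_ball
  set D := Metric.ball (0 : Eucl N) (2 * r) with hDdef
  have hDm : MeasurableSet D := measurableSet_ball
  have hB0 : volume B ≠ 0 := (Metric.measure_ball_pos _ _ hr).ne'
  have hBt : volume B ≠ ⊤ := measure_ball_lt_top.ne
  refine ⟨((volume D * ENNReal.ofReal (2 * r) ^ P) / volume B) ^ (1 / P), ?_,
    fun u g hum hu hg hw => ?_⟩
  · refine ENNReal.rpow_ne_top_of_nonneg (by positivity) (ENNReal.div_ne_top ?_ hB0)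
    exact ENNReal.mul_ne_top measure_ball_lt_top.ne
      (ENNReal.rpow_ne_top_of_nonneg hP0.le ENNReal.ofReal_ne_top)
  set G := ∫⁻ x in Ω, ‖g x‖ₑ ^ P with hG
  have hpair : Measurable fun q : Eucl N × Eucl N => ‖u q.2 - u q.1‖ₑ ^ P := by fun_prop
  have hpair' : Measurable fun q : Eucl N × Eucl N => ‖u (q.1 + q.2) - u q.1‖ₑ ^ P := by fun_prop
  have htr : ∀ h ∈ D, ∫⁻ x in B, ‖u (x + h) - u x‖ₑ ^ P ≤ ENNReal.ofReal (2 * r) ^ P * G := by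
    intro h hh
    have hh' : ‖h‖ < 2 * r := by simpa [hDdef] using hh
    refine (lintegral_translate_sub_le hΩ hp hu hg hw hP hBm ?_).trans ?_
    · intro x hx t ht
      apply hB
      have hx' : ‖x - x₀‖ < r := by simpa [hBdef, dist_eq_norm] using hx
      rw [Metric.mem_ball, dist_eq_norm]
      calc ‖x + t • h - x₀‖ = ‖(x - x₀) + t • h‖ := by congr 1; abel
        _ ≤ ‖x - x₀‖ + ‖t • h‖ := norm_add_le _ _
        _ ≤ ‖x - x₀‖ + 1 * ‖h‖ := by
            rw [norm_smul, Real.norm_of_nonneg ht.1]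
            gcongr
            exact ht.2
        _ < 3 * r := by linarith
    · gcongr
      rw [← ofReal_norm]
      exact ENNReal.ofReal_le_ofReal hh'.le
  have hdouble : ∫⁻ y in B, ∫⁻ x in B, ‖u x - u y‖ₑ ^ P ≤
      volume D * ENNReal.ofReal (2 * r) ^ P * G := by
    calc ∫⁻ y in B, ∫⁻ x in B, ‖u x - u y‖ₑ ^ P
        ≤ ∫⁻ y in B, ∫⁻ h in D, ‖u (y + h) - u y‖ₑ ^ P := by
          refine setLIntegral_mono' hBm fun y hy => ?_
          rw [← lintegral_indicator hBm, ← lintegral_indicator hDm,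
            ← lintegral_add_left_eq_self _ y]
          refine lintegral_mono fun h => ?_
          by_cases hyh : y + h ∈ B
          · have hhD : h ∈ D := by
              rw [hDdef, mem_ball_zero_iff]
              calc ‖h‖ = ‖(y + h - x₀) - (y - x₀)‖ := by congr 1; abel
                _ ≤ ‖y + h - x₀‖ + ‖y - x₀‖ := norm_sub_le _ _
                _ < r + r := by
                  rw [← dist_eq_norm, ← dist_eq_norm]
                  exact add_lt_add hyh hy
                _ = 2 * r := by ring
            rw [Set.indicator_of_mem hyh, Set.indicator_of_mem hhD]
          · rw [Set.indicator_of_notMem hyh]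
            exact zero_le
      _ = ∫⁻ h in D, ∫⁻ y in B, ‖u (y + h) - u y‖ₑ ^ P :=
          lintegral_lintegral_swap hpair'.aemeasurable
      _ ≤ ∫⁻ h in D, ENNReal.ofReal (2 * r) ^ P * G := setLIntegral_mono' hDm htr
      _ = _ := by
          rw [setLIntegral_const]; ring
  -- Some y has an inner integral at most the average over B; the constant c is u(y) for this y.
  obtain ⟨y, -, hy⟩ := exists_le_setLAverage (μ := volume)
    (f := fun y => ∫⁻ x in B, ‖u x - u y‖ₑ ^ P) hB0 hBt
    (Measurable.lintegral_prod_right' hpair).aemeasurable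
  refine ⟨u y, ?_⟩
  rw [setLAverage_eq] at hy
  rw [eLpNorm_eq_lintegral_rpow_enorm_toReal hp0 hp', eLpNorm_eq_lintegral_rpow_enorm_toReal hp0 hp',
    ← ENNReal.mul_rpow_of_nonneg _ _ (by positivity)]
  refine ENNReal.rpow_le_rpow (hy.trans ?_) (by positivity)
  rw [← ENNReal.mul_div_right_comm]
  exact ENNReal.div_le_div_right hdouble _

theorem eLpNorm_union_le {α : Type*} [MeasurableSpace α] {μ : Measure α} {E : Type*}
    [NormedAddCommGroup E] (hp : 1 ≤ p) (hp' : p ≠ ⊤) (f : α → E) (U V : Set α) :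
    eLpNorm f p (μ.restrict (U ∪ V)) ≤ eLpNorm f p (μ.restrict U) + eLpNorm f p (μ.restrict V) := by
  have hp0 : p ≠ 0 := (zero_lt_one.trans_le hp).ne'
  have hP : 1 ≤ p.toReal := by
    simpa using ENNReal.toReal_mono hp' hp
  have hP0 : 0 < p.toReal := by linarith
  simp only [eLpNorm_eq_lintegral_rpow_enorm_toReal hp0 hp']
  refine (ENNReal.rpow_le_rpow (lintegral_union_le _ U V) (by positivity)).trans ?_
  exact ENNReal.rpow_add_le_add_rpow _ _ (by positivity) (by rw [div_le_one hP0]; exact hP)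

/-- On the overlap, u is close both to c and to k, so |k - c| |U ∩ V|^(1/p) is bounded by the
gradient norm. Positive measure of the overlap bounds |k - c|, and finite measure of V then allows k
to be replaced by c on V. -/
theorem IsPoincareSet.union (hp : 1 ≤ p) (hp' : p ≠ ⊤) (hU : IsPoincareSet p Ω U)
    (hV : IsPoincareSet p Ω V) (hUV : volume (U ∩ V) ≠ 0) (hVt : volume V ≠ ⊤) :
    IsPoincareSet p Ω (U ∪ V) := by
  have hp0 : p ≠ 0 := (zero_lt_one.trans_le hp).ne'
  obtain ⟨C, hC, hCU⟩ := hU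
  obtain ⟨K, hK, hKV⟩ := hV
  set m := volume (U ∩ V) ^ (1 / p.toReal) with hm
  set M := volume V ^ (1 / p.toReal) with hM
  have hUVt : volume (U ∩ V) ≠ ⊤ := ((measure_mono Set.inter_subset_right).trans_lt hVt.lt_top).ne
  have hm0 : m ≠ 0 := (ENNReal.rpow_pos (pos_iff_ne_zero.2 hUV) hUVt).ne'
  have hmt : m ≠ ⊤ := ENNReal.rpow_ne_top_of_nonneg (by positivity) hUVt
  have hMt : M ≠ ⊤ := ENNReal.rpow_ne_top_of_nonneg (by positivity) hVt
  refine ⟨C + (K + (C + K) / m * M), ?_, fun u g hum hu hg hw => ?_⟩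
  · simp [hC, hK, ENNReal.mul_eq_top, hMt, ENNReal.div_eq_top, hm0, hmt]
  obtain ⟨c, hc⟩ := hCU u g hum hu hg hw
  obtain ⟨k, hk⟩ := hKV u g hum hu hg hw
  set G := eLpNorm g p (leb Ω)
  have hmeas : ∀ (c : ℝ) (W : Set (Eucl N)), AEStronglyMeasurable (fun x => u x - c) (leb W) :=
    fun c W => (hum.sub_const c).aestronglyMeasurable
  have h1 : ‖k - c‖ₑ * m ≤ (C + K) * G := by
    have e : (fun _ : Eucl N => k - c) = (fun x => u x - c) - fun x => u x - k := by
      ext x; simp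
    calc ‖k - c‖ₑ * m = eLpNorm (fun _ : Eucl N => k - c) p (leb (U ∩ V)) := by
          rw [eLpNorm_const' _ hp0 hp', Measure.restrict_apply_univ]
      _ ≤ eLpNorm (fun x => u x - c) p (leb (U ∩ V)) +
          eLpNorm (fun x => u x - k) p (leb (U ∩ V)) := by
          rw [e]; exact eLpNorm_sub_le (hmeas _ _) (hmeas _ _) hp
      _ ≤ C * G + K * G := by
          refine add_le_add (le_trans (eLpNorm_mono_measure _ ?_) hc)
            (le_trans (eLpNorm_mono_measure _ ?_) hk)
          · exact Measure.restrict_mono Set.inter_subset_left le_rfl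
          · exact Measure.restrict_mono Set.inter_subset_right le_rfl
      _ = _ := by ring
  have h2 : ‖k - c‖ₑ ≤ (C + K) / m * G := by
    rw [← ENNReal.mul_div_right_comm, ENNReal.le_div_iff_mul_le (Or.inl hm0) (Or.inl hmt)]
    exact h1
  have h3 : eLpNorm (fun x => u x - c) p (leb V) ≤ (K + (C + K) / m * M) * G := by
    have e : (fun x => u x - c) = (fun x => u x - k) + fun _ => k - c := by
      ext x; simp
    calc _ ≤ eLpNorm (fun x => u x - k) p (leb V) + eLpNorm (fun _ : Eucl N => k - c) p (leb V) := by
          rw [e]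
          exact eLpNorm_add_le (hmeas _ _) aestronglyMeasurable_const hp
      _ ≤ K * G + (C + K) / m * G * M := by
          rw [eLpNorm_const' _ hp0 hp', Measure.restrict_apply_univ]
          gcongr
      _ = _ := by ring
  refine ⟨c, (eLpNorm_union_le hp hp' _ U V).trans ?_⟩
  rw [add_mul]
  exact add_le_add hc h3

/-- By compactness finitely many W k cover Ω. Take a maximal subfamily S containing k₀ whose union
is a Poincaré set. If it missed a point of Ω, connectedness would make it meet some W k with k
outside S, in a nonempty open set and so in positive measure; adding k would contradict maximality.
-/
theorem isPoincareSet_of_locally (hp : 1 ≤ p) (hp' : p ≠ ⊤) (hΩ : IsOpen Ω) (hconn : IsConnected Ω)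
    (hb : Bornology.IsBounded Ω)
    (hloc : ∀ x ∈ closure Ω, ∃ W, IsOpen W ∧ x ∈ W ∧ IsPoincareSet p Ω (W ∩ Ω)) :
    IsPoincareSet p Ω Ω := by
  classical
  choose! W hWo hxW hWP using hloc
  obtain ⟨T, hTcl, hTcov⟩ := hb.isCompact_closure.elim_nhds_subcover W
    fun x hx => (hWo x hx).mem_nhds (hxW x hx)
  have hcov : ∀ y ∈ Ω, ∃ k ∈ T, y ∈ W k := by
    intro y hy
    simpa using hTcov (subset_closure hy)
  obtain ⟨y₀, hy₀⟩ := hconn.nonempty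
  obtain ⟨k₀, hk₀T, hk₀⟩ := hcov y₀ hy₀
  let good : Finset (Eucl N) → Prop := fun S => S ⊆ T ∧ k₀ ∈ S ∧
    IsPoincareSet p Ω (⋃ k ∈ S, W k ∩ Ω)
  have hfin : {S | good S}.Finite := T.powerset.finite_toSet.subset fun S hS => by
    simpa using hS.1
  obtain ⟨S, hS, hmax⟩ := hfin.exists_maximal
    ⟨{k₀}, by simpa using hk₀T, by simp, by simpa using hWP k₀ (hTcl k₀ hk₀T)⟩
  obtain ⟨hST, hk₀S, hSP⟩ := hS
  have hopen : ∀ k ∈ T, IsOpen (W k ∩ Ω) := fun k hk => (hWo k (hTcl k hk)).inter hΩ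
  have hO₁ : IsOpen (⋃ k ∈ S, W k ∩ Ω) := isOpen_biUnion fun k hk => hopen k (hST hk)
  have hO₂ : IsOpen (⋃ k ∈ T \ S, W k ∩ Ω) := isOpen_biUnion fun k hk =>
    hopen k (Finset.mem_sdiff.1 hk).1
  have heq : (⋃ k ∈ S, W k ∩ Ω) = Ω := by
    refine Set.Subset.antisymm (Set.iUnion₂_subset fun k _ => Set.inter_subset_right) ?_
    intro y hy
    by_contra hyS
    have hyO₂ : y ∈ ⋃ k ∈ T \ S, W k ∩ Ω := by
      obtain ⟨k, hkT, hyk⟩ := hcov y hy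
      refine Set.mem_iUnion₂.2 ⟨k, Finset.mem_sdiff.2 ⟨hkT, fun hkS => hyS ?_⟩, hyk, hy⟩
      exact Set.mem_iUnion₂.2 ⟨k, hkS, hyk, hy⟩
    have hsub : Ω ⊆ (⋃ k ∈ S, W k ∩ Ω) ∪ ⋃ k ∈ T \ S, W k ∩ Ω := by
      intro x hx
      obtain ⟨k, hkT, hxk⟩ := hcov x hx
      by_cases hkS : k ∈ S
      · exact Or.inl (Set.mem_iUnion₂.2 ⟨k, hkS, hxk, hx⟩)
      · exact Or.inr (Set.mem_iUnion₂.2 ⟨k, Finset.mem_sdiff.2 ⟨hkT, hkS⟩, hxk, hx⟩)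
    obtain ⟨z, hzΩ, hz₁, hz₂⟩ := hconn.isPreconnected _ _ hO₁ hO₂ hsub
      ⟨y₀, hy₀, Set.mem_iUnion₂.2 ⟨k₀, hk₀S, hk₀, hy₀⟩⟩ ⟨y, hy, hyO₂⟩
    obtain ⟨k, hk, hzk⟩ := Set.mem_iUnion₂.1 hz₂
    obtain ⟨hkT, hkS⟩ := Finset.mem_sdiff.1 hk
    have hnew : good (insert k S) := by
      refine ⟨Finset.insert_subset hkT hST, Finset.mem_insert_of_mem hk₀S, ?_⟩
      rw [Finset.set_biUnion_insert, Set.union_comm]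
      refine hSP.union hp hp' (hWP k (hTcl k hkT)) ?_ ?_
      · exact (hO₁.inter (hopen k hkT)).measure_ne_zero volume ⟨z, hz₁, hzk⟩
      · exact ((measure_mono Set.inter_subset_right).trans_lt hb.measure_lt_top).ne
    exact hkS (hmax hnew (Finset.subset_insert _ _) (Finset.mem_insert_self _ _))
  rwa [heq] at hSP

/-- At a boundary point, `Ω` can be pushed into its interior. -/
theorem HasC1Boundary.exists_translate (hΩ : IsOpen Ω) (hC : HasC1Boundary Ω) {x₀ : Eucl N}
    (hx₀ : x₀ ∈ frontier Ω) : ∃ (h : Eucl N) (δ : ℝ), 0 < δ ∧ Metric.ball (x₀ + h) (3 * δ) ⊆ Ω ∧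
      ∀ x ∈ Metric.ball x₀ δ ∩ Ω, ∀ t ∈ Set.Icc (0 : ℝ) 1, x + t • h ∈ Ω := by
  obtain ⟨r, hr, e, he, γ, hγ, hiff⟩ := hC x₀ hx₀
  set π := (Submodule.span ℝ {e})ᗮ.orthogonalProjectionOnto with hπ
  have hπe : ∀ (x : Eucl N) (s : ℝ), π (x + s • e) = π x := by
    intro x s
    have h0 : π e = 0 :=
      Submodule.orthogonalProjectionOnto_orthogonalComplement_singleton_eq_zero e
    rw [map_add, map_smul, h0, smul_zero, add_zero]
  have hin : ∀ (x : Eucl N) (s : ℝ), inner ℝ e (x + s • e) = inner ℝ e x + s := by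
    intro x s
    rw [inner_add_right, inner_smul_right, real_inner_self_eq_norm_sq, he]
    ring
  -- A boundary point strictly below the graph would have a neighbourhood disjoint from Ω.
  have hle : γ (π x₀) ≤ inner ℝ e x₀ := by
    by_contra! hlt
    have hO : IsOpen {x | inner ℝ e x < γ (π x)} :=
      isOpen_lt (by fun_prop) (hγ.continuous.comp π.continuous)
    obtain ⟨y, ⟨hy₁, hy₂⟩, hyΩ⟩ := mem_closure_iff.1 (frontier_subset_closure hx₀) _
      (hO.inter Metric.isOpen_ball) ⟨hlt, Metric.mem_ball_self hr⟩
    exact lt_asymm hy₁ ((hiff y hy₂).1 hyΩ)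
  set h : Eucl N := (r / 2) • e with hh
  have hnh : ‖h‖ = r / 2 := by
    rw [hh, norm_smul, he, mul_one, Real.norm_of_nonneg (by linarith)]
  have hx₁ : x₀ + h ∈ Ω := by
    rw [hiff]
    · rw [hh, hπe, hin]; linarith
    · rw [Metric.mem_ball, dist_eq_norm, add_sub_cancel_left, hnh]; linarith
  obtain ⟨η, hη, hηΩ⟩ := Metric.isOpen_iff.1 hΩ _ hx₁
  -- η/3 keeps the ball of radius 3δ around x₀ + h inside Ω; r/2, together with ‖h‖ = r/2, keeps x +
  -- t h in the chart of radius r.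
  refine ⟨h, min (η / 3) (r / 2), by positivity, ?_, ?_⟩
  · refine (Metric.ball_subset_ball ?_).trans hηΩ
    have := min_le_left (η / 3) (r / 2)
    linarith
  · rintro x ⟨hxb, hxΩ⟩ t ht
    have hxr : ‖x - x₀‖ < r / 2 := by
      rw [← dist_eq_norm]
      exact lt_of_lt_of_le hxb (min_le_right _ _)
    have h1 : γ (π x) < inner ℝ e x := by
      rwa [hiff] at hxΩ
      rw [Metric.mem_ball, dist_eq_norm]; linarith
    have e1 : t • h = (t * (r / 2)) • e := by rw [hh, smul_smul]
    rw [hiff]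
    · rw [e1, hπe, hin]
      have := mul_nonneg ht.1 (by linarith : 0 ≤ r / 2)
      linarith
    · rw [Metric.mem_ball, dist_eq_norm]
      calc ‖x + t • h - x₀‖ = ‖(x - x₀) + t • h‖ := by congr 1; abel
        _ ≤ ‖x - x₀‖ + ‖t • h‖ := norm_add_le _ _
        _ ≤ ‖x - x₀‖ + 1 * ‖h‖ := by
            rw [norm_smul, Real.norm_of_nonneg ht.1]
            gcongr
            exact ht.2
        _ < r := by linarith

/-- Interior points have small balls; near a boundary point, the domain is pushed into a ball inside
Ω. -/
theorem IsC1Domain.isPoincareSet (hp : 1 ≤ p) (hp' : p ≠ ⊤) (hΩ : IsC1Domain Ω) :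
    IsPoincareSet p Ω Ω := by
  refine isPoincareSet_of_locally hp hp' hΩ.isOpen hΩ.isConnected hΩ.isBounded fun x hx => ?_
  by_cases hxΩ : x ∈ Ω
  · obtain ⟨η, hη, hηΩ⟩ := Metric.isOpen_iff.1 hΩ.isOpen _ hxΩ
    have hsub : Metric.ball x (3 * (η / 3)) ⊆ Ω := by
      rwa [mul_div_cancel₀ _ (by norm_num : (3 : ℝ) ≠ 0)]
    refine ⟨Metric.ball x (η / 3), Metric.isOpen_ball, Metric.mem_ball_self (by positivity), ?_⟩
    rw [Set.inter_eq_left.2 ((Metric.ball_subset_ball (by linarith)).trans hsub)]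
    exact isPoincareSet_ball hΩ.isOpen hp hp' (by positivity) hsub
  · have hxf : x ∈ frontier Ω := by
      rw [hΩ.isOpen.frontier_eq]; exact ⟨hx, hxΩ⟩
    obtain ⟨h, δ, hδ, hball, htr⟩ := hΩ.hasC1Boundary.exists_translate hΩ.isOpen hxf
    refine ⟨Metric.ball x δ, Metric.isOpen_ball, Metric.mem_ball_self hδ, ?_⟩
    refine isPoincareSet_of_translate hΩ.isOpen hp hp'
      (isPoincareSet_ball hΩ.isOpen hp hp' hδ hball) measurableSet_ball
      (measurableSet_ball.inter hΩ.isOpen.measurableSet) htr fun y hy => ?_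
    have := hy.1
    rw [Metric.mem_ball] at this ⊢
    simpa using this

end Poincare

/-! ### Poincaré inequality with the mean over a subset. -/

section PoincareMean

variable {N : ℕ} {p : ℝ≥0∞} [Fact (1 ≤ p)] {Ω Ω' : Set (Eucl N)}

/-- Integration against a bounded function, as a functional on `Lᵖ`. -/
theorem exists_integral_mul_clm {α : Type*} [MeasurableSpace α] {μ : Measure α}
    [IsFiniteMeasure μ] {f : α → ℝ} (hf : AEStronglyMeasurable f μ) {C : ℝ}
    (hC : ∀ᵐ x ∂μ, ‖f x‖ ≤ C) :
    ∃ ℓ : Lp ℝ p μ →L[ℝ] ℝ, ∀ u, ℓ u = ∫ x, f x * u x ∂μ := by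
  have hq : Fact (1 ≤ p.conjExponent) := ⟨by simp [ENNReal.conjExponent]⟩
  have : p.conjExponent.HolderConjugate p := ENNReal.HolderConjugate.symm
  have hfq : MemLp f p.conjExponent μ := MemLp.of_bound hf C hC
  refine ⟨(ContinuousLinearMap.mul ℝ ℝ).lpPairing μ p.conjExponent p (hfq.toLp f), fun u => ?_⟩
  rw [ContinuousLinearMap.lpPairing_eq_integral]
  refine integral_congr_ae ?_
  filter_upwards [hfq.coeFn_toLp] with x hx
  simp [hx]

theorem isFiniteMeasure_leb (hb : Bornology.IsBounded Ω) : IsFiniteMeasure (leb Ω) :=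
  ⟨by simpa using hb.measure_lt_top⟩

theorem exists_setIntegral_clm (hΩ : MeasurableSet Ω) (hsub : Ω ⊆ Ω')
    (hb : Bornology.IsBounded Ω') :
    ∃ ℓ : Lp ℝ p (leb Ω') →L[ℝ] ℝ, ∀ u, ℓ u = ∫ x in Ω, u x := by
  have := isFiniteMeasure_leb hb
  obtain ⟨ℓ, hℓ⟩ := exists_integral_mul_clm (p := p) (μ := leb Ω') (f := Ω.indicator fun _ => 1)
    (C := 1) (measurable_const.indicator hΩ).aestronglyMeasurable (ae_of_all _ fun x => by
      by_cases hx : x ∈ Ω <;> simp [hx])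
  refine ⟨ℓ, fun u => ?_⟩
  rw [hℓ]
  have e : (fun x => Ω.indicator (fun _ => (1 : ℝ)) x * u x) = Ω.indicator u := by
    ext x
    by_cases hx : x ∈ Ω <;> simp [hx]
  rw [e, integral_indicator hΩ, Measure.restrict_restrict hΩ, Set.inter_eq_left.2 hsub]

/-- **Poincaré inequality** with control of the mean over a subset. -/
theorem IsC1Domain.exists_norm_le (hp' : p ≠ ⊤) (hΩ' : IsC1Domain Ω') (hΩ : MeasurableSet Ω)
    (hsub : Ω ⊆ Ω') (h0 : volume Ω ≠ 0) :
    ∃ C : ℝ, 0 ≤ C ∧ ∀ z : Sobolev p Ω', ‖z.1.1‖ ≤ C * (‖z.1.2‖ + |∫ x in Ω, z.1.1 x|) := by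
  have hp : 1 ≤ p := Fact.out
  have := isFiniteMeasure_leb hΩ'.isBounded
  obtain ⟨C, hC, hP⟩ := hΩ'.isPoincareSet hp hp'
  obtain ⟨ℓ, hℓ⟩ := exists_setIntegral_clm (p := p) hΩ hsub hΩ'.isBounded
  let one : Lp ℝ p (leb Ω') := (memLp_const (1 : ℝ)).toLp _
  have hone : one =ᵐ[leb Ω'] fun _ => (1 : ℝ) := MemLp.coeFn_toLp _
  set m := volume.real Ω with hm
  have hm0 : 0 < m := by
    refine ENNReal.toReal_pos h0 ?_
    exact ((measure_mono hsub).trans_lt hΩ'.isBounded.measure_lt_top).ne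
  have hℓone : ℓ one = m := by
    rw [hℓ, integral_congr_ae (ae_mono (Measure.restrict_mono hsub le_rfl) hone)]
    simp [hm]
  have hmain : ∀ z : Sobolev p Ω', ∃ c : ℝ, ‖z.1.1 - c • one‖ ≤ C.toReal * ‖z.1.2‖ := by
    intro z
    have hum := Lp.aestronglyMeasurable z.1.1
    have hw : IsWeakGradient Ω' (hum.mk _) z.1.2 := by
      intro φ h1 h2 h3 y
      rw [← z.2 φ h1 h2 h3 y]
      refine integral_congr_ae ?_
      filter_upwards [hum.ae_eq_mk] with x hx
      rw [hx]
    obtain ⟨c, hc⟩ := hP (hum.mk _) z.1.2 hum.stronglyMeasurable_mk.measurable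
      ((Lp.memLp z.1.1).ae_eq hum.ae_eq_mk) (Lp.aestronglyMeasurable _) hw
    refine ⟨c, ?_⟩
    rw [Lp.norm_def, Lp.norm_def, ← ENNReal.toReal_mul]
    refine ENNReal.toReal_mono (ENNReal.mul_ne_top hC (Lp.eLpNorm_ne_top _)) (le_trans (le_of_eq ?_) hc)
    refine eLpNorm_congr_ae ?_
    filter_upwards [Lp.coeFn_sub z.1.1 (c • one), Lp.coeFn_smul c one, hone, hum.ae_eq_mk]
      with x k1 k2 k3 k4
    rw [k1, Pi.sub_apply, k2, Pi.smul_apply, k3, k4]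
    simp
  set L := ‖ℓ‖ with hL
  refine ⟨C.toReal + ‖one‖ / m * (1 + L * C.toReal), by positivity, fun z => ?_⟩
  obtain ⟨c, hc⟩ := hmain z
  set A := ‖z.1.2‖
  set I := |∫ x in Ω, z.1.1 x| with hI
  -- Integrating u - c over Ω recovers c from the mean of u, up to a gradient error.
  have hcm : |c| * m ≤ I + L * (C.toReal * A) := by
    have e : c * m = (∫ x in Ω, z.1.1 x) - ℓ (z.1.1 - c • one) := by
      rw [map_sub, map_smul, hℓone, hℓ, smul_eq_mul]; ring
    calc |c| * m = |c * m| := by rw [abs_mul, abs_of_pos hm0]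
      _ ≤ I + |ℓ (z.1.1 - c • one)| := by rw [e]; exact abs_sub _ _
      _ ≤ I + L * (C.toReal * A) := by
        gcongr
        exact (ℓ.le_opNorm _).trans (by gcongr)
  have hcm' : |c| ≤ (I + L * (C.toReal * A)) / m := by rwa [le_div_iff₀ hm0]
  have hA : 0 ≤ A := norm_nonneg _
  have hI0 : 0 ≤ I := abs_nonneg _
  calc ‖z.1.1‖ = ‖(z.1.1 - c • one) + c • one‖ := by rw [sub_add_cancel]
    _ ≤ ‖z.1.1 - c • one‖ + ‖c • one‖ := norm_add_le _ _
    _ ≤ C.toReal * A + (I + L * (C.toReal * A)) / m * ‖one‖ := by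
        rw [norm_smul, Real.norm_eq_abs]
        gcongr
    _ = C.toReal * A + ‖one‖ / m * (I + L * C.toReal * A) := by ring
    _ ≤ C.toReal * (A + I) + ‖one‖ / m * ((1 + L * C.toReal) * (A + I)) := by
        have : I + L * C.toReal * A ≤ (1 + L * C.toReal) * (A + I) := by
          have : 0 ≤ L * C.toReal * I := by positivity
          nlinarith
        gcongr
        linarith
    _ = _ := by ring

end PoincareMean

/-! ### The energy space is reflexive. -/

section EnergySpaceReflexive

variable {N : ℕ} {p : ℝ≥0∞} [Fact (1 ≤ p)] {Ω Ω' : Set (Eucl N)}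

/-- Taking coordinates makes the vector-valued space a retract of (Lᵖ)ᴺ. -/
theorem isReflexiveSpace_Lp_eucl {α : Type*} [MeasurableSpace α] {μ : Measure α}
    [IsFiniteMeasure μ] (hp₁ : 1 < p) (hp₂ : p ≠ ⊤) : IsReflexiveSpace (Lp (Eucl N) p μ) := by
  let T : Lp (Eucl N) p μ →L[ℝ] (Fin N → Lp ℝ p μ) := ContinuousLinearMap.pi fun i =>
    (EuclideanSpace.proj i : Eucl N →L[ℝ] ℝ).compLpL p μ
  let S : (Fin N → Lp ℝ p μ) →L[ℝ] Lp (Eucl N) p μ := ∑ i,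
    ((ContinuousLinearMap.toSpanSingleton ℝ (EuclideanSpace.single i (1 : ℝ))).compLpL p μ) ∘L
      ContinuousLinearMap.proj i
  refine (IsReflexiveSpace.pi fun _ : Fin N => isReflexiveSpace_Lp hp₁ hp₂).of_leftInverse T S
    fun g => ?_
  have hS : S (T g) = ∑ i, (ContinuousLinearMap.toSpanSingleton ℝ
      (EuclideanSpace.single i (1 : ℝ))).compLp ((EuclideanSpace.proj i : Eucl N →L[ℝ] ℝ).compLp g) := by
    simp only [S, T, sum_apply, ContinuousLinearMap.comp_apply]
    rfl
  rw [hS]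
  refine Lp.ext ?_
  refine (Lp.coeFn_finsetSum _ _).trans ?_
  have h1 : ∀ᵐ x ∂μ, ∀ i : Fin N, (ContinuousLinearMap.toSpanSingleton ℝ
      (EuclideanSpace.single i (1 : ℝ))).compLp ((EuclideanSpace.proj i : Eucl N →L[ℝ] ℝ).compLp g) x
      = g x i • EuclideanSpace.single i (1 : ℝ) := by
    rw [ae_all_iff]
    intro i
    filter_upwards [ContinuousLinearMap.coeFn_compLp (EuclideanSpace.proj i : Eucl N →L[ℝ] ℝ) g,
      ContinuousLinearMap.coeFn_compLp (ContinuousLinearMap.toSpanSingleton ℝ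
        (EuclideanSpace.single i (1 : ℝ))) ((EuclideanSpace.proj i : Eucl N →L[ℝ] ℝ).compLp g)]
      with x k1 k2
    rw [k2, k1]
    simp
  filter_upwards [h1] with x hx
  rw [Finset.sum_apply, Finset.sum_congr rfl fun i _ => hx i]
  ext j
  simp [Finset.sum_apply, Pi.single_apply]

/-- For fixed φ and y, φ and its derivative are bounded, so the weak gradient identity equates two
continuous functionals. -/
theorem isClosed_sobolev (hb : Bornology.IsBounded Ω) :
    IsClosed (Sobolev p Ω : Set (Lp ℝ p (leb Ω) × Lp (Eucl N) p (leb Ω))) := by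
  have := isFiniteMeasure_leb hb
  have e : (Sobolev p Ω : Set (Lp ℝ p (leb Ω) × Lp (Eucl N) p (leb Ω))) =
      {z | ∀ φ : Eucl N → ℝ, ContDiff ℝ (⊤ : ℕ∞) φ → HasCompactSupport φ → tsupport φ ⊆ Ω →
        ∀ y : Eucl N, ∫ x in Ω, fderiv ℝ φ x y * z.1 x = - ∫ x in Ω, φ x * inner ℝ (z.2 x) y} := rfl
  rw [e]
  simp only [Set.ofPred_forall]
  refine isClosed_iInter fun φ => isClosed_iInter fun hφ => isClosed_iInter fun hφc =>
    isClosed_iInter fun _ => isClosed_iInter fun y => ?_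
  have hd : Continuous fun x => fderiv ℝ φ x y :=
    (hφ.continuous_fderiv (by simp)).clm_apply continuous_const
  obtain ⟨C, hC⟩ := (hφc.fderiv_apply ℝ y).exists_bound_of_continuous hd
  obtain ⟨K, hK⟩ := hφc.exists_bound_of_continuous hφ.continuous
  obtain ⟨ℓ, hℓ⟩ := exists_integral_mul_clm (p := p) (μ := leb Ω) hd.aestronglyMeasurable
    (ae_of_all _ hC)
  obtain ⟨κ, hκ⟩ := exists_integral_mul_clm (p := p) (μ := leb Ω) hφ.continuous.aestronglyMeasurable
    (ae_of_all _ hK)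
  have hκ' : ∀ g : Lp (Eucl N) p (leb Ω), κ ((innerSL ℝ y).compLpL p (leb Ω) g) =
      ∫ x in Ω, φ x * inner ℝ (g x) y := by
    intro g
    rw [hκ]
    refine integral_congr_ae ?_
    filter_upwards [ContinuousLinearMap.coeFn_compLpL (innerSL ℝ y) g] with x hx
    rw [hx, innerSL_apply_apply, real_inner_comm]
  simp_rw [← hℓ, ← hκ']
  exact isClosed_eq (by fun_prop) (by fun_prop)

/-- The a.e. identity v = u_i - u_e is equivalent to equality of the integrals over all measurable
subsets of Ω. Each of these is a closed condition, although the three functions live in different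
Lebesgue spaces. -/
theorem isClosed_energySpace (hm : MeasurableSet Ω) (hsub : Ω ⊆ Ω') (hb : Bornology.IsBounded Ω)
    (hb' : Bornology.IsBounded Ω') :
    IsClosed (EnergySpace p hsub hb : Set (Sobolev p Ω × Sobolev p Ω' × Lp ℝ 2 (leb Ω) ×
      Lp ℝ 2 (leb Ω))) := by
  have := isFiniteMeasure_leb hb
  have hp : 1 ≤ p := Fact.out
  have e : (EnergySpace p hsub hb : Set (Sobolev p Ω × Sobolev p Ω' × Lp ℝ 2 (leb Ω) ×
      Lp ℝ 2 (leb Ω))) = {z | ∫ x in Ω, z.2.1.1.1 x = 0} ∩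
        {z | ∀ A, MeasurableSet A → A ⊆ Ω →
          ∫ x in A, z.2.2.2 x = (∫ x in A, z.1.1.1 x) - ∫ x in A, z.2.1.1.1 x} := by
    ext z
    have hi₁ : Integrable z.2.2.2 (leb Ω) := (Lp.memLp z.2.2.2).integrable (by norm_num)
    have hi₂ : Integrable z.1.1.1 (leb Ω) := (Lp.memLp z.1.1.1).integrable hp
    have hi₃ : Integrable z.2.1.1.1 (leb Ω) := integrable_restrict hp hsub hb _
    refine and_congr_right fun _ => ⟨fun h A hA hAΩ => ?_, fun h => ?_⟩
    · have hle : leb A ≤ leb Ω := Measure.restrict_mono hAΩ le_rfl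
      rw [← integral_sub (hi₂.mono_measure hle) (hi₃.mono_measure hle)]
      exact integral_congr_ae (ae_mono hle h)
    · refine Integrable.ae_eq_of_forall_setIntegral_eq _ _ hi₁ (hi₂.sub hi₃) fun A hA _ => ?_
      have hAm := hA.inter hm
      have hle : leb (A ∩ Ω) ≤ leb Ω := Measure.restrict_mono Set.inter_subset_right le_rfl
      rw [Measure.restrict_restrict hA, integral_sub (hi₂.mono_measure hle) (hi₃.mono_measure hle)]
      exact h _ hAm Set.inter_subset_right
  rw [e]
  refine IsClosed.inter ?_ ?_
  · obtain ⟨ℓ, hℓ⟩ := exists_setIntegral_clm (p := p) hm hsub hb'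
    simp_rw [← hℓ]
    exact isClosed_eq (by fun_prop) continuous_const
  · simp only [Set.ofPred_forall]
    refine isClosed_iInter fun A => isClosed_iInter fun hA => isClosed_iInter fun hAΩ => ?_
    obtain ⟨ℓ₁, h₁⟩ := exists_setIntegral_clm (p := 2) hA hAΩ hb
    obtain ⟨ℓ₂, h₂⟩ := exists_setIntegral_clm (p := p) hA hAΩ hb
    obtain ⟨ℓ₃, h₃⟩ := exists_setIntegral_clm (p := p) hA (hAΩ.trans hsub) hb'
    simp_rw [← h₁, ← h₂, ← h₃]
    exact isClosed_eq (by fun_prop) (by fun_prop)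

theorem isReflexiveSpace_energySpace (hp₁ : 1 < p) (hp₂ : p ≠ ⊤) (hm : MeasurableSet Ω)
    (hsub : Ω ⊆ Ω') (hb : Bornology.IsBounded Ω) (hb' : Bornology.IsBounded Ω') :
    IsReflexiveSpace (EnergySpace p hsub hb) := by
  have := isFiniteMeasure_leb hb
  have := isFiniteMeasure_leb hb'
  have hS := ((isReflexiveSpace_Lp hp₁ hp₂).prod (isReflexiveSpace_Lp_eucl hp₁ hp₂)).submodule
    (isClosed_sobolev (p := p) hb)
  have hS' := ((isReflexiveSpace_Lp hp₁ hp₂).prod (isReflexiveSpace_Lp_eucl hp₁ hp₂)).submodule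
    (isClosed_sobolev (p := p) hb')
  have hL : IsReflexiveSpace (Lp ℝ 2 (leb Ω)) := isReflexiveSpace_Lp (by norm_num) (by norm_num)
  have := (isClosed_sobolev (p := p) hb).completeSpace_coe
  have := (isClosed_sobolev (p := p) hb').completeSpace_coe
  exact (hS.prod (hS'.prod (hL.prod hL))).submodule (isClosed_energySpace hm hsub hb hb')

end EnergySpaceReflexive

/-! ### Integrands: semiconvexity, Fatou, extended integrals. -/

section Integrands

theorem le_sub_of_convexOn_of_hasFDerivAt {E : Type*} [NormedAddCommGroup E] [NormedSpace ℝ E]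
    {f : E → ℝ} (hf : ConvexOn ℝ Set.univ f) {D : E →L[ℝ] ℝ} (hD : HasFDerivAt f D 0) (z : E) :
    D z ≤ f z - f 0 := by
  have hline : HasDerivAt (fun t : ℝ => f (t • z)) (D z) 0 := by
    have h1 : HasDerivAt (fun t : ℝ => t • z) z 0 := by
      simpa using (hasDerivAt_id (0 : ℝ)).smul_const z
    have hD' : HasFDerivAt f D ((0 : ℝ) • z) := by rwa [zero_smul]
    exact hD'.comp_hasDerivAt 0 h1
  have hc : ConvexOn ℝ Set.univ fun t : ℝ => f (t • z) := by
    have := hf.comp_linearMap (LinearMap.toSpanSingleton ℝ E z)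
    simpa [Function.comp_def] using this
  have := hc.le_slope_of_hasDerivAt (Set.mem_univ 0) (Set.mem_univ 1) zero_lt_one hline
  simpa [slope] using this

/-- A differentiable convex function lies above its tangent plane at 0, hence decreases at most
linearly; a further quadratic term absorbs this and leaves quadratic growth. -/
theorem IsSemiconvex.exists_convexOn {F : ℝ × ℝ → ℝ} (hF : Differentiable ℝ F)
    (hF' : IsSemiconvex F) :
    ∃ ω C : ℝ, (ConvexOn ℝ Set.univ fun z : ℝ × ℝ => F z + (ω / 2 * (z.1 ^ 2 + z.2 ^ 2) + C)) ∧
      ∀ z : ℝ × ℝ, z.1 ^ 2 + z.2 ^ 2 ≤ F z + (ω / 2 * (z.1 ^ 2 + z.2 ^ 2) + C) := by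
  obtain ⟨ω, hω⟩ := hF'
  set f : ℝ × ℝ → ℝ := fun z => F z + ω / 2 * (z.1 ^ 2 + z.2 ^ 2) with hf
  have hd : Differentiable ℝ f := by fun_prop
  set D := fderiv ℝ f 0
  have hsq : ConvexOn ℝ Set.univ fun z : ℝ × ℝ => z.1 ^ 2 + z.2 ^ 2 := by
    have h2 : ConvexOn ℝ Set.univ fun t : ℝ => t ^ 2 := even_two.convexOn_pow
    exact (h2.comp_linearMap (LinearMap.fst ℝ ℝ ℝ)).add (h2.comp_linearMap (LinearMap.snd ℝ ℝ ℝ))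
  -- Passing from ω to ω + 4 adds 2|z|²: one |z|² pays for ‖D‖‖z‖ ≤ ‖z‖² + ‖D‖²/4, the other is the
  -- lower bound.
  refine ⟨ω + 4, ‖D‖ ^ 2 / 4 - f 0, ?_, fun z => ?_⟩
  · have h := (hω.add (hsq.smul (c := 2) (by norm_num))).add_const (‖D‖ ^ 2 / 4 - f 0)
    refine h.congr fun z _ => ?_
    simp only [Pi.add_apply, smul_eq_mul]
    ring
  · have h1 := le_sub_of_convexOn_of_hasFDerivAt hω (hd 0).hasFDerivAt z
    have h2 : -(‖D‖ * ‖z‖) ≤ D z := by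
      have := (abs_le.1 ((Real.norm_eq_abs _).symm.le.trans (D.le_opNorm z))).1
      exact this
    have h3 : ‖z‖ ^ 2 ≤ z.1 ^ 2 + z.2 ^ 2 := by
      rw [Prod.norm_def]
      rcases max_choice ‖z.1‖ ‖z.2‖ with h | h <;> rw [h, Real.norm_eq_abs, sq_abs] <;>
        nlinarith [sq_nonneg z.1, sq_nonneg z.2]
    have h4 : ‖D‖ * ‖z‖ ≤ ‖z‖ ^ 2 + ‖D‖ ^ 2 / 4 := by nlinarith [sq_nonneg (‖z‖ - ‖D‖ / 2)]
    have h5 : f z = F z + ω / 2 * (z.1 ^ 2 + z.2 ^ 2) := rfl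
    have h6 : D z ≤ f z - f 0 := h1
    linarith

/-- Composition of a Carathéodory function with a measurable function is measurable. -/
theorem aemeasurable_caratheodory {α E : Type*} [MeasurableSpace α] {μ : Measure α}
    [TopologicalSpace E] {Q : α → E → ℝ}
    (hm : ∀ y, AEMeasurable (fun x => Q x y) μ) (hc : ∀ᵐ x ∂μ, Continuous (Q x)) {g : α → E}
    (hg : AEStronglyMeasurable g μ) : AEMeasurable (fun x => Q x (g x)) μ := by
  have hsimple : ∀ s : SimpleFunc α E, AEMeasurable (fun x => Q x (s x)) μ := by
    intro s
    have e : (fun x => Q x (s x)) =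
        ∑ y ∈ s.range, (s ⁻¹' {y}).indicator (fun x => Q x y) := by
      classical
      ext x
      rw [Finset.sum_apply, Finset.sum_eq_single_of_mem (s x) (s.mem_range_self x)]
      · simp
      · intro y _ hy
        exact Set.indicator_of_notMem (fun h => hy (Eq.symm h)) _
    rw [e]
    exact Finset.aemeasurable_sum _ fun y _ => (hm y).indicator (s.measurableSet_fiber y)
  refine aemeasurable_of_tendsto_metrizable_ae atTop
    (fun n => hsimple (hg.stronglyMeasurable_mk.approx n)) ?_
  filter_upwards [hc, hg.ae_eq_mk] with x hx hgx
  rw [hgx]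
  exact (hx.tendsto _).comp (hg.stronglyMeasurable_mk.tendsto_approx x)

/-- Fatou's lemma shows that sublevel sets are sequentially closed. The indices n k need not
increase: every term of the sequence already lies in the sublevel set. -/
theorem lowerSemicontinuous_lintegral {X α E : Type*} [TopologicalSpace X] [SequentialSpace X]
    [MeasurableSpace α] {μ : Measure α} [TopologicalSpace E] {Ψ : α → E → ℝ≥0∞} {S : X → α → E}
    (hm : ∀ z, AEMeasurable (fun x => Ψ x (S z x)) μ) (hc : ∀ᵐ x ∂μ, Continuous (Ψ x))
    (hS : ∀ (y : ℕ → X) (z : X), Tendsto y atTop (𝓝 z) → ∃ n : ℕ → ℕ,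
      ∀ᵐ x ∂μ, Tendsto (fun k => S (y (n k)) x) atTop (𝓝 (S z x))) :
    LowerSemicontinuous fun z => ∫⁻ x, Ψ x (S z x) ∂μ := by
  rw [lowerSemicontinuous_iff_isClosed_preimage]
  refine fun c => IsSeqClosed.isClosed fun y z hy hyz => ?_
  obtain ⟨n, hn⟩ := hS y z hyz
  calc ∫⁻ x, Ψ x (S z x) ∂μ = ∫⁻ x, liminf (fun k => Ψ x (S (y (n k)) x)) atTop ∂μ := by
        refine lintegral_congr_ae ?_
        filter_upwards [hc, hn] with x h1 h2
        exact ((h1.tendsto _).comp h2).liminf_eq.symm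
    _ ≤ liminf (fun k => ∫⁻ x, Ψ x (S (y (n k)) x) ∂μ) atTop := lintegral_liminf_le' fun k => hm _
    _ ≤ c := by
        refine liminf_le_of_le (by isBoundedDefault) fun b hb => ?_
        obtain ⟨k, hk⟩ := hb.exists
        exact hk.trans (hy (n k))

theorem lintegral_convexOn_le {α E : Type*} [MeasurableSpace α] {μ : Measure α}
    [AddCommGroup E] [Module ℝ E] {Φ : α → E → ℝ} {f g h : α → E} {a b : ℝ} (ha : 0 ≤ a)
    (hb : 0 ≤ b) (hab : a + b = 1) (hΦ : ∀ᵐ x ∂μ, ConvexOn ℝ Set.univ (Φ x))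
    (h0 : ∀ᵐ x ∂μ, ∀ y, 0 ≤ Φ x y) (hm : AEMeasurable (fun x => Φ x (f x)) μ)
    (hh : ∀ᵐ x ∂μ, h x = a • f x + b • g x) :
    ∫⁻ x, ENNReal.ofReal (Φ x (h x)) ∂μ ≤ ENNReal.ofReal a * ∫⁻ x, ENNReal.ofReal (Φ x (f x)) ∂μ +
      ENNReal.ofReal b * ∫⁻ x, ENNReal.ofReal (Φ x (g x)) ∂μ := by
  rw [← lintegral_const_mul' _ _ ENNReal.ofReal_ne_top,
    ← lintegral_const_mul' _ _ ENNReal.ofReal_ne_top,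
    ← lintegral_add_left' (hm.ennreal_ofReal.const_mul _)]
  refine lintegral_mono_ae ?_
  filter_upwards [hΦ, h0, hh] with x h1 h2 h3
  rw [← ENNReal.ofReal_mul ha, ← ENNReal.ofReal_mul hb,
    ← ENNReal.ofReal_add (mul_nonneg ha (h2 _)) (mul_nonneg hb (h2 _)), h3]
  exact ENNReal.ofReal_le_ofReal (h1.2 (Set.mem_univ _) (Set.mem_univ _) ha hb hab)

theorem extIntegral_of_nonneg {α : Type*} [MeasurableSpace α] {μ : Measure α} {f : α → ℝ}
    (hf : ∀ᵐ x ∂μ, 0 ≤ f x) :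
    extIntegral μ f = ((∫⁻ x, ENNReal.ofReal (f x) ∂μ : ℝ≥0∞) : EReal) := by
  have h0 : ∫⁻ x, ENNReal.ofReal (-f x) ∂μ = 0 := by
    rw [lintegral_congr_ae (g := fun _ => 0), lintegral_zero]
    filter_upwards [hf] with x hx
    exact ENNReal.ofReal_of_nonpos (by linarith)
  rw [extIntegral, h0]
  simp

theorem coe_ennreal_eq_coe_toReal {a : ℝ≥0∞} (ha : a ≠ ⊤) :
    (a : EReal) = ((a.toReal : ℝ) : EReal) := by
  lift a to NNReal using ha
  rfl

/-- From f + h ≥ 0 the negative part of f is dominated by |h|, so only the positive part can have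
infinite integral. If f is not integrable, both sides are ⊤. -/
theorem extIntegral_eq_lintegral_add_sub {α : Type*} [MeasurableSpace α] {μ : Measure α}
    {f h : α → ℝ} (hf : AEMeasurable f μ) (hh : Integrable h μ) (h0 : ∀ᵐ x ∂μ, 0 ≤ f x + h x) :
    extIntegral μ f = ((∫⁻ x, ENNReal.ofReal (f x + h x) ∂μ : ℝ≥0∞) : EReal) -
      ((∫ x, h x ∂μ : ℝ) : EReal) := by
  have hneg : ∫⁻ x, ENNReal.ofReal (-f x) ∂μ ≠ ⊤ := by
    refine (lt_of_le_of_lt (lintegral_mono_ae ?_) hh.2).ne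
    filter_upwards [h0] with x hx
    exact (ENNReal.ofReal_le_ofReal (by linarith)).trans (Real.ofReal_le_enorm _)
  by_cases hfi : Integrable f μ
  · have hfh : Integrable (fun x => f x + h x) μ := hfi.add hh
    have hpos : ∫⁻ x, ENNReal.ofReal (f x) ∂μ ≠ ⊤ := hfi.lintegral_lt_top.ne
    have e := integral_eq_lintegral_pos_part_sub_lintegral_neg_part hfi
    rw [extIntegral, coe_ennreal_eq_coe_toReal hpos, coe_ennreal_eq_coe_toReal hneg,
      ← EReal.coe_sub, ← e, ← ofReal_integral_eq_lintegral_ofReal hfh h0,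
      EReal.coe_ennreal_ofReal, max_eq_left (integral_nonneg_of_ae h0), ← EReal.coe_sub]
    congr 1
    rw [integral_add hfi hh, add_sub_cancel_right]
  · have hpos : ∫⁻ x, ENNReal.ofReal (f x) ∂μ = ⊤ := by
      by_contra hne
      refine hfi ⟨hf.aestronglyMeasurable, ?_⟩
      have hle : ∀ x, ‖f x‖ₑ ≤ ENNReal.ofReal (f x) + ENNReal.ofReal (-f x) := by
        intro x
        rw [← ofReal_norm, Real.norm_eq_abs]
        rcases abs_choice (f x) with h | h <;> rw [h]
        · exact le_self_add
        · exact le_add_self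
      refine lt_of_le_of_lt (lintegral_mono hle) ?_
      rw [lintegral_add_left' hf.ennreal_ofReal]
      exact ENNReal.add_lt_top.2 ⟨lt_top_iff_ne_top.2 hne, lt_top_iff_ne_top.2 hneg⟩
    have hsum : ∫⁻ x, ENNReal.ofReal (f x + h x) ∂μ = ⊤ := by
      by_contra hne
      have hfh : Integrable (fun x => f x + h x) μ :=
        (lintegral_ofReal_ne_top_iff_integrable (hf.aestronglyMeasurable.add hh.1) h0).1 hne
      refine hfi ((hfh.sub hh).congr (ae_of_all _ fun x => ?_))
      simp
    rw [extIntegral, hpos, hsum, coe_ennreal_eq_coe_toReal hneg]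
    simp

end Integrands

/-! ### Normal form of the energy. -/

section EnergyFormula

variable {N : ℕ} {p : ℝ≥0∞} {Ω Ω' : Set (Eucl N)}

theorem IsFluxPotential.nonneg {Q : Eucl N → Eucl N → ℝ} (hQ : IsFluxPotential p Ω Q)
    {x : Eucl N} (hx : x ∈ Ω) (y : Eucl N) : 0 ≤ Q x y := by
  obtain ⟨α, hα, h⟩ := hQ.lower_bound
  exact le_trans (by positivity) (h x hx y)

theorem IsFluxPotential.continuous {Q : Eucl N → Eucl N → ℝ} (hQ : IsFluxPotential p Ω Q)
    {x : Eucl N} (hx : x ∈ Ω) : Continuous (Q x) :=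
  (hQ.differentiable x hx).continuous

theorem IsFluxPotential.aemeasurable_comp {Q : Eucl N → Eucl N → ℝ} (hQ : IsFluxPotential p Ω Q)
    (hΩ : MeasurableSet Ω) {g : Eucl N → Eucl N} (hg : AEStronglyMeasurable g (leb Ω)) :
    AEMeasurable (fun x => Q x (g x)) (leb Ω) :=
  aemeasurable_caratheodory hQ.aemeasurable
    ((ae_restrict_mem hΩ).mono fun _ hx => hQ.continuous hx) hg

theorem coeFn_smul_add_smul {α E : Type*} [MeasurableSpace α] {μ : Measure α}
    [NormedAddCommGroup E] [NormedSpace ℝ E] (a b : ℝ) (f g : Lp E p μ) :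
    ∀ᵐ x ∂μ, (a • f + b • g : Lp E p μ) x = a • f x + b • g x := by
  filter_upwards [Lp.coeFn_add (a • f) (b • g), Lp.coeFn_smul a f, Lp.coeFn_smul b g]
    with x h1 h2 h3
  rw [h1, Pi.add_apply, h2, h3, Pi.smul_apply, Pi.smul_apply]

variable [Fact (1 ≤ p)] {hsub : Ω ⊆ Ω'} {hb : Bornology.IsBounded Ω}

/-- The `L²` class of `u_i - u_e`. -/
def vComp (z : EnergySpace p hsub hb) : Eucl N → ℝ := z.1.2.2.2

theorem vComp_ae (z : EnergySpace p hsub hb) :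
    vComp z =ᵐ[leb Ω] fun x => uᵢ z x - uₑ z x :=
  z.2.2

/-- The sum of the three energies, where `F` is replaced by `G ≥ 0`. -/
def nonnegEnergy (Qᵢ Qₑ : Eucl N → Eucl N → ℝ) (G : ℝ × ℝ → ℝ) (z : EnergySpace p hsub hb) :
    ℝ≥0∞ :=
  (∫⁻ x in Ω, ENNReal.ofReal (Qᵢ x (gradUᵢ z x))) +
    (∫⁻ x in Ω', ENNReal.ofReal (Qₑ x (gradUₑ z x))) +
      ∫⁻ x in Ω, ENNReal.ofReal (G (vComp z x, wComp z x))

theorem aestronglyMeasurable_pair (z : EnergySpace p hsub hb) :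
    AEStronglyMeasurable (fun x => (vComp z x, wComp z x)) (leb Ω) :=
  (Lp.aestronglyMeasurable z.1.2.2.2).prodMk (Lp.aestronglyMeasurable z.1.2.2.1)

theorem norm_sq_eq_integral {α : Type*} [MeasurableSpace α] {μ : Measure α} (f : Lp ℝ 2 μ) :
    ‖f‖ ^ 2 = ∫ x, f x ^ 2 ∂μ := by
  rw [← real_inner_self_eq_norm_sq, L2.inner_def]
  refine integral_congr_ae (ae_of_all _ fun x => ?_)
  simp [sq]

/-- The square of the norm of `j z`. -/
def jNormSq (z : EnergySpace p hsub hb) : ℝ := ‖z.1.2.2.2‖ ^ 2 + ‖z.1.2.2.1‖ ^ 2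

theorem norm_jMap_sq (z : EnergySpace p hsub hb) : ‖jMap p hsub hb z‖ ^ 2 = jNormSq z :=
  WithLp.prod_norm_sq_eq_of_L2 _

theorem integrable_quadratic (ω C : ℝ) (z : EnergySpace p hsub hb) :
    Integrable (fun x => ω / 2 * (vComp z x ^ 2 + wComp z x ^ 2) + C) (leb Ω) ∧
    ∫ x in Ω, (ω / 2 * (vComp z x ^ 2 + wComp z x ^ 2) + C) =
      ω / 2 * jNormSq z + C * volume.real Ω := by
  have := isFiniteMeasure_leb hb
  have hv : Integrable (fun x => vComp z x ^ 2) (leb Ω) := (Lp.memLp z.1.2.2.2).integrable_sq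
  have hw : Integrable (fun x => wComp z x ^ 2) (leb Ω) := (Lp.memLp z.1.2.2.1).integrable_sq
  have h1 : Integrable (fun x => ω / 2 * (vComp z x ^ 2 + wComp z x ^ 2)) (leb Ω) :=
    (hv.add hw).const_mul _
  refine ⟨h1.add (integrable_const C), ?_⟩
  rw [integral_add h1 (integrable_const C), integral_const_mul, integral_add hv hw, jNormSq,
    norm_sq_eq_integral, norm_sq_eq_integral]
  simp only [integral_const, measureReal_restrict_apply MeasurableSet.univ, Set.univ_inter,
    smul_eq_mul]
  rw [mul_comm C]
  rfl

theorem energyF_eq {F G : ℝ × ℝ → ℝ} (hF : Continuous F) {ω C : ℝ}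
    (hG : ∀ y, G y = F y + (ω / 2 * (y.1 ^ 2 + y.2 ^ 2) + C)) (h0 : ∀ y, 0 ≤ G y)
    (z : EnergySpace p hsub hb) :
    energyF F z = ((∫⁻ x in Ω, ENNReal.ofReal (G (vComp z x, wComp z x)) : ℝ≥0∞) : EReal) -
      ((ω / 2 * jNormSq z + C * volume.real Ω : ℝ) : EReal) := by
  have e : ∀ s : ℝ, ∫⁻ x in Ω, ENNReal.ofReal (s * F (uᵢ z x - uₑ z x, wComp z x)) =
      ∫⁻ x in Ω, ENNReal.ofReal (s * F (vComp z x, wComp z x)) := by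
    intro s
    refine lintegral_congr_ae ?_
    filter_upwards [vComp_ae z] with x hx
    rw [hx]
  have e' : energyF F z = extIntegral (leb Ω) fun x => F (vComp z x, wComp z x) := by
    have e₁ := e 1
    have e₂ := e (-1)
    simp only [one_mul, neg_mul] at e₁ e₂
    rw [energyF, extIntegral, extIntegral, e₁, e₂]
  obtain ⟨h1, h2⟩ := integrable_quadratic ω C z
  have hm : AEMeasurable (fun x => F (vComp z x, wComp z x)) (leb Ω) :=
    (hF.comp_aestronglyMeasurable (aestronglyMeasurable_pair z)).aemeasurable
  have h3 := extIntegral_eq_lintegral_add_sub hm h1 (ae_of_all _ fun x => by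
    rw [← hG (vComp z x, wComp z x)]; exact h0 _)
  rw [e', h3, h2]
  congr 2
  refine lintegral_congr fun x => ?_
  rw [hG]

theorem energyᵢ_eq {Qᵢ : Eucl N → Eucl N → ℝ} (hΩ : MeasurableSet Ω)
    (hQᵢ : IsFluxPotential p Ω Qᵢ) (z : EnergySpace p hsub hb) :
    energyᵢ Qᵢ z = ((∫⁻ x in Ω, ENNReal.ofReal (Qᵢ x (gradUᵢ z x)) : ℝ≥0∞) : EReal) :=
  extIntegral_of_nonneg ((ae_restrict_mem hΩ).mono fun _ hx => hQᵢ.nonneg hx _)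

theorem energyₑ_eq {Qₑ : Eucl N → Eucl N → ℝ} (hΩ' : MeasurableSet Ω')
    (hQₑ : IsFluxPotential p Ω' Qₑ) (z : EnergySpace p hsub hb) :
    energyₑ Qₑ z = ((∫⁻ x in Ω', ENNReal.ofReal (Qₑ x (gradUₑ z x)) : ℝ≥0∞) : EReal) :=
  extIntegral_of_nonneg ((ae_restrict_mem hΩ').mono fun _ hx => hQₑ.nonneg hx _)

/-- The identity behind all assertions: a [0, ∞]-valued convex functional minus a finite term that
is affine in ‖j z‖². -/
theorem energy_eq {Qᵢ Qₑ : Eucl N → Eucl N → ℝ} (hΩ : MeasurableSet Ω) (hΩ' : MeasurableSet Ω')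
    (hQᵢ : IsFluxPotential p Ω Qᵢ) (hQₑ : IsFluxPotential p Ω' Qₑ) {F G : ℝ × ℝ → ℝ}
    (hF : Continuous F) {ω C : ℝ} (hG : ∀ y, G y = F y + (ω / 2 * (y.1 ^ 2 + y.2 ^ 2) + C))
    (h0 : ∀ y, 0 ≤ G y) (z : EnergySpace p hsub hb) :
    energy p hsub hb Qᵢ Qₑ F z = (nonnegEnergy Qᵢ Qₑ G z : EReal) -
        ((ω / 2 * jNormSq z + C * volume.real Ω : ℝ) : EReal) := by
  rw [energy, energyᵢ_eq hΩ hQᵢ, energyₑ_eq hΩ' hQₑ, energyF_eq hF hG h0, nonnegEnergy,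
    EReal.coe_ennreal_add, EReal.coe_ennreal_add, sub_eq_add_neg, sub_eq_add_neg, add_assoc,
    add_assoc, add_assoc]

/-! ### Lower semicontinuity and convexity of the nonnegative energy. -/

theorem exists_seq_tendsto_ae_of_tendsto_Lp {α E : Type*} [MeasurableSpace α] {μ : Measure α}
    [NormedAddCommGroup E] {f : ℕ → Lp E p μ} {g : Lp E p μ} (h : Tendsto f atTop (𝓝 g)) :
    ∃ n : ℕ → ℕ, StrictMono n ∧ ∀ᵐ x ∂μ, Tendsto (fun k => f (n k) x) atTop (𝓝 (g x)) :=
  (tendstoInMeasure_of_tendsto_Lp h).exists_seq_tendsto_ae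

theorem lowerSemicontinuous_nonnegEnergy {Qᵢ Qₑ : Eucl N → Eucl N → ℝ} (hΩ : MeasurableSet Ω)
    (hΩ' : MeasurableSet Ω') (hQᵢ : IsFluxPotential p Ω Qᵢ) (hQₑ : IsFluxPotential p Ω' Qₑ)
    {G : ℝ × ℝ → ℝ} (hG : Continuous G) :
    LowerSemicontinuous (nonnegEnergy (hsub := hsub) (hb := hb) (p := p) Qᵢ Qₑ G) := by
  refine (LowerSemicontinuous.add ?_ ?_).add ?_
  · refine lowerSemicontinuous_lintegral (Ψ := fun x y => ENNReal.ofReal (Qᵢ x y)) (S := gradUᵢ)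
      (fun z => (hQᵢ.aemeasurable_comp hΩ (Lp.aestronglyMeasurable _)).ennreal_ofReal)
      ((ae_restrict_mem hΩ).mono fun x hx => ENNReal.continuous_ofReal.comp (hQᵢ.continuous hx))
      fun y z hyz => ?_
    have hc : Continuous fun z : EnergySpace p hsub hb => z.1.1.1.2 := by fun_prop
    obtain ⟨n, -, hn⟩ := exists_seq_tendsto_ae_of_tendsto_Lp ((hc.tendsto z).comp hyz)
    exact ⟨n, hn⟩
  · refine lowerSemicontinuous_lintegral (Ψ := fun x y => ENNReal.ofReal (Qₑ x y)) (S := gradUₑ)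
      (fun z => (hQₑ.aemeasurable_comp hΩ' (Lp.aestronglyMeasurable _)).ennreal_ofReal)
      ((ae_restrict_mem hΩ').mono fun x hx => ENNReal.continuous_ofReal.comp (hQₑ.continuous hx))
      fun y z hyz => ?_
    have hc : Continuous fun z : EnergySpace p hsub hb => z.1.2.1.1.2 := by fun_prop
    obtain ⟨n, -, hn⟩ := exists_seq_tendsto_ae_of_tendsto_Lp ((hc.tendsto z).comp hyz)
    exact ⟨n, hn⟩
  · refine lowerSemicontinuous_lintegral (Ψ := fun _ y => ENNReal.ofReal (G y))
      (S := fun z x => (vComp z x, wComp z x))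
      (fun z => (hG.comp_aestronglyMeasurable
        (aestronglyMeasurable_pair z)).aemeasurable.ennreal_ofReal)
      (ae_of_all _ fun _ => ENNReal.continuous_ofReal.comp hG) fun y z hyz => ?_
    have hc₁ : Continuous fun z : EnergySpace p hsub hb => z.1.2.2.2 := by fun_prop
    have hc₂ : Continuous fun z : EnergySpace p hsub hb => z.1.2.2.1 := by fun_prop
    obtain ⟨n, hn, hn'⟩ := exists_seq_tendsto_ae_of_tendsto_Lp ((hc₁.tendsto z).comp hyz)
    -- The second extraction runs along the first subsequence, so that both components converge a.e.
    obtain ⟨m, hm, hm'⟩ := exists_seq_tendsto_ae_of_tendsto_Lp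
      ((hc₂.tendsto z).comp (hyz.comp hn.tendsto_atTop))
    refine ⟨fun k => n (m k), ?_⟩
    filter_upwards [hn', hm'] with x h1 h2
    exact (h1.comp hm.tendsto_atTop).prodMk_nhds h2

theorem nonnegEnergy_convex {Qᵢ Qₑ : Eucl N → Eucl N → ℝ} (hΩ : MeasurableSet Ω)
    (hΩ' : MeasurableSet Ω') (hQᵢ : IsFluxPotential p Ω Qᵢ) (hQₑ : IsFluxPotential p Ω' Qₑ)
    {G : ℝ × ℝ → ℝ} (hG : Continuous G) (hGc : ConvexOn ℝ Set.univ G) (hG0 : ∀ z, 0 ≤ G z)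
    (u v : EnergySpace p hsub hb) {a b : ℝ} (ha : 0 ≤ a) (hb' : 0 ≤ b) (hab : a + b = 1) :
    nonnegEnergy Qᵢ Qₑ G (a • u + b • v) ≤
      ENNReal.ofReal a * nonnegEnergy Qᵢ Qₑ G u + ENNReal.ofReal b * nonnegEnergy Qᵢ Qₑ G v := by
  have h1 := lintegral_convexOn_le (μ := leb Ω) (Φ := Qᵢ) (f := gradUᵢ u) (g := gradUᵢ v)
    (h := gradUᵢ (a • u + b • v)) ha hb' hab
    ((ae_restrict_mem hΩ).mono fun x hx => (hQᵢ.strictConvexOn x hx).convexOn)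
    ((ae_restrict_mem hΩ).mono fun x hx => hQᵢ.nonneg hx)
    (hQᵢ.aemeasurable_comp hΩ (Lp.aestronglyMeasurable _))
    (coeFn_smul_add_smul a b u.1.1.1.2 v.1.1.1.2)
  have h2 := lintegral_convexOn_le (μ := leb Ω') (Φ := Qₑ) (f := gradUₑ u) (g := gradUₑ v)
    (h := gradUₑ (a • u + b • v)) ha hb' hab
    ((ae_restrict_mem hΩ').mono fun x hx => (hQₑ.strictConvexOn x hx).convexOn)
    ((ae_restrict_mem hΩ').mono fun x hx => hQₑ.nonneg hx)
    (hQₑ.aemeasurable_comp hΩ' (Lp.aestronglyMeasurable _))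
    (coeFn_smul_add_smul a b u.1.2.1.1.2 v.1.2.1.1.2)
  have h3 := lintegral_convexOn_le (μ := leb Ω) (Φ := fun _ => G)
    (f := fun x => (vComp u x, wComp u x)) (g := fun x => (vComp v x, wComp v x))
    (h := fun x => (vComp (a • u + b • v) x, wComp (a • u + b • v) x)) ha hb' hab
    (ae_of_all _ fun _ => hGc) (ae_of_all _ fun _ => hG0)
    (hG.comp_aestronglyMeasurable (aestronglyMeasurable_pair u)).aemeasurable (by
      filter_upwards [coeFn_smul_add_smul a b u.1.2.2.2 v.1.2.2.2,
        coeFn_smul_add_smul a b u.1.2.2.1 v.1.2.2.1] with x k1 k2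
      exact Prod.ext k1 k2)
  refine (add_le_add (add_le_add h1 h2) h3).trans (le_of_eq ?_)
  simp only [nonnegEnergy]
  ring

theorem isConvexFun_of_ennreal {V : Type*} [NormedAddCommGroup V] [NormedSpace ℝ V]
    {K : V → ℝ≥0∞} {c : ℝ} (hK : ∀ u v : V, ∀ a b : ℝ, 0 ≤ a → 0 ≤ b → a + b = 1 →
      K (a • u + b • v) ≤ ENNReal.ofReal a * K u + ENNReal.ofReal b * K v) :
    IsConvexFun fun u => (K u : EReal) - (c : EReal) := by
  intro u v a b ha hb hab
  -- In `EReal`, 0 * ⊤ = 0, so the argument that an infinite value makes the right-hand side ⊤ needs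
  -- positive weights.
  rcases ha.eq_or_lt with rfl | ha'
  · have : b = 1 := by linarith
    subst this
    simp
  rcases hb.eq_or_lt with rfl | hb'
  · have : a = 1 := by linarith
    subst this
    simp
  have hbot : ∀ (x : ℝ≥0∞) (t : ℝ), 0 < t → (t : EReal) * ((x : EReal) - (c : EReal)) ≠ ⊥ := by
    intro x t ht
    by_cases hx : x = ⊤
    · rw [hx]
      simp [EReal.coe_mul_top_of_pos ht]
    · rw [coe_ennreal_eq_coe_toReal hx, ← EReal.coe_sub, ← EReal.coe_mul]
      exact EReal.coe_ne_bot _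
  by_cases hu : K u = ⊤
  · have e : (a : EReal) * ((K u : EReal) - (c : EReal)) = ⊤ := by
      rw [hu]
      simp [EReal.coe_mul_top_of_pos ha']
    simp only [e]
    rw [EReal.top_add_of_ne_bot (hbot _ _ hb')]
    exact le_top
  by_cases hv : K v = ⊤
  · have e : (b : EReal) * ((K v : EReal) - (c : EReal)) = ⊤ := by
      rw [hv]
      simp [EReal.coe_mul_top_of_pos hb']
    simp only [e]
    rw [EReal.add_top_of_ne_bot (hbot _ _ ha')]
    exact le_top
  have hle := hK u v a b ha hb hab
  have hfin : ENNReal.ofReal a * K u + ENNReal.ofReal b * K v ≠ ⊤ :=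
    ENNReal.add_ne_top.2 ⟨ENNReal.mul_ne_top ENNReal.ofReal_ne_top hu,
      ENNReal.mul_ne_top ENNReal.ofReal_ne_top hv⟩
  have hw : K (a • u + b • v) ≠ ⊤ := (lt_of_le_of_lt hle hfin.lt_top).ne
  have hreal := ENNReal.toReal_mono hfin hle
  rw [ENNReal.toReal_add (ENNReal.mul_ne_top ENNReal.ofReal_ne_top hu)
    (ENNReal.mul_ne_top ENNReal.ofReal_ne_top hv), ENNReal.toReal_mul, ENNReal.toReal_mul,
    ENNReal.toReal_ofReal ha, ENNReal.toReal_ofReal hb] at hreal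
  simp only [coe_ennreal_eq_coe_toReal hu, coe_ennreal_eq_coe_toReal hv,
    coe_ennreal_eq_coe_toReal hw, ← EReal.coe_sub, ← EReal.coe_mul, ← EReal.coe_add]
  rw [EReal.coe_le_coe_iff]
  have e : a * ((K u).toReal - c) + b * ((K v).toReal - c) =
      a * (K u).toReal + b * (K v).toReal - (a + b) * c := by ring
  rw [e, hab]
  linarith

/-! ### Boundedness of sublevel sets. -/

theorem ofReal_norm_rpow_eq_lintegral {α E : Type*} [MeasurableSpace α] {μ : Measure α}
    [NormedAddCommGroup E] (hp₂ : p ≠ ⊤) (f : Lp E p μ) :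
    ENNReal.ofReal (‖f‖ ^ p.toReal) = ∫⁻ x, ‖f x‖ₑ ^ p.toReal ∂μ := by
  have hp : 1 ≤ p := Fact.out
  have hp0 : p ≠ 0 := (zero_lt_one.trans_le hp).ne'
  have hP0 : 0 < p.toReal := ENNReal.toReal_pos hp0 hp₂
  rw [← ENNReal.ofReal_rpow_of_nonneg (norm_nonneg _) hP0.le, ofReal_norm, Lp.enorm_def,
    eLpNorm_eq_lintegral_rpow_enorm_toReal hp0 hp₂, ← ENNReal.rpow_mul, one_div,
    inv_mul_cancel₀ hP0.ne', ENNReal.rpow_one]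

/-- A crude bound suffices: t ≤ t^p for t ≥ 1, so ‖f‖ is at most 1 or at most M. -/
theorem norm_le_of_lintegral_le {α E : Type*} [MeasurableSpace α] {μ : Measure α}
    [NormedAddCommGroup E] (hp₂ : p ≠ ⊤) (f : Lp E p μ) {M : ℝ} (hM : 0 ≤ M)
    (h : ∫⁻ x, ‖f x‖ₑ ^ p.toReal ∂μ ≤ ENNReal.ofReal M) : ‖f‖ ≤ 1 + M := by
  have hp : 1 ≤ p := Fact.out
  have hP : 1 ≤ p.toReal := by simpa using ENNReal.toReal_mono hp₂ hp
  rw [← ofReal_norm_rpow_eq_lintegral hp₂, ENNReal.ofReal_le_ofReal_iff hM] at h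
  by_cases h1 : ‖f‖ ≤ 1
  · linarith
  · have := Real.self_le_rpow_of_one_le (not_le.1 h1).le hP
    linarith

theorem IsFluxPotential.exists_norm_le {Q : Eucl N → Eucl N → ℝ} (hQ : IsFluxPotential p Ω Q)
    (hΩ : MeasurableSet Ω) (hp₂ : p ≠ ⊤) (M : ℝ) : ∃ R : ℝ, ∀ g : Lp (Eucl N) p (leb Ω),
      ∫⁻ x in Ω, ENNReal.ofReal (Q x (g x)) ≤ ENNReal.ofReal M → ‖g‖ ≤ R := by
  obtain ⟨α, hα, h⟩ := hQ.lower_bound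
  refine ⟨1 + max M 0 / α, fun g hg => norm_le_of_lintegral_le hp₂ g (by positivity) ?_⟩
  rw [ENNReal.ofReal_div_of_pos hα, ENNReal.le_div_iff_mul_le (by simp [hα]) (by simp), mul_comm,
    ← lintegral_const_mul' _ _ ENNReal.ofReal_ne_top]
  refine le_trans ?_ (hg.trans (ENNReal.ofReal_le_ofReal (le_max_left _ _)))
  refine setLIntegral_mono' hΩ fun x hx => ?_
  rw [← ofReal_norm, ENNReal.ofReal_rpow_of_nonneg (norm_nonneg _) ENNReal.toReal_nonneg,
    ← ENNReal.ofReal_mul hα.le]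
  exact ENNReal.ofReal_le_ofReal (h x hx _)

/-- The mean of u_i is not prescribed; since u_e has mean zero over Ω, the L² norm of v controls it.
-/
theorem integral_uᵢ_eq (z : EnergySpace p hsub hb) :
    ∫ x in Ω, uᵢ z x = ∫ x in Ω, vComp z x := by
  have hp : 1 ≤ p := Fact.out
  have := isFiniteMeasure_leb hb
  have hi₁ : Integrable (uᵢ z) (leb Ω) := (Lp.memLp z.1.1.1.1).integrable hp
  have hi₂ : Integrable (uₑ z) (leb Ω) := integrable_restrict hp hsub hb _
  have h0 : ∫ x in Ω, uₑ z x = 0 := z.2.1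
  rw [integral_congr_ae (vComp_ae z), integral_sub hi₁ hi₂, h0, sub_zero]

theorem le_mul_add_of_le {r s t I C₁ C₂ L : ℝ} (hC₁ : 0 ≤ C₁) (hC₂ : 0 ≤ C₂) (hL : 0 ≤ L)
    (hs : 0 ≤ s) (ht : 0 ≤ t) (h1 : r ≤ C₁ * (s + I)) (h2 : I ≤ L * t) :
    r ≤ (C₁ * (1 + L) + C₂) * (s + t) :=
  calc r ≤ C₁ * (s + L * t) := h1.trans (by gcongr)
    _ ≤ C₁ * ((1 + L) * (s + t)) := by
      gcongr
      have : 0 ≤ L * s := by positivity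
      nlinarith
    _ ≤ C₁ * ((1 + L) * (s + t)) + C₂ * (s + t) := le_add_of_nonneg_right (by positivity)
    _ = _ := by ring

-- Poincaré on Ω for u_i, with its mean estimated through v, and on Ω' for u_e, whose mean over Ω
-- vanishes.
set_option maxHeartbeats 1000000 in
theorem exists_norm_components_le (hp₂ : p ≠ ⊤) (hΩ : IsC1Domain Ω) (hΩ' : IsC1Domain Ω') :
    ∃ C : ℝ, 0 ≤ C ∧ ∀ z : EnergySpace p hsub hb,
      ‖z.1.1.1.1‖ ≤ C * (‖z.1.1.1.2‖ + ‖z.1.2.2.2‖) ∧ ‖z.1.2.1.1.1‖ ≤ C * ‖z.1.2.1.1.2‖ := by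
  have hm := hΩ.isOpen.measurableSet
  have hvol : volume Ω ≠ 0 := hΩ.isOpen.measure_ne_zero volume hΩ.isConnected.nonempty
  obtain ⟨C₁, hC₁, hP₁⟩ := hΩ.exists_norm_le hp₂ hm subset_rfl hvol
  obtain ⟨C₂, hC₂, hP₂⟩ := hΩ'.exists_norm_le hp₂ hm hsub hvol
  obtain ⟨ℓ, hℓ⟩ := exists_setIntegral_clm (p := 2) hm (subset_refl Ω) hb
  refine ⟨C₁ * (1 + ‖ℓ‖) + C₂, by positivity, fun z => ⟨?_, ?_⟩⟩
  · have h1 : ‖z.1.1.1.1‖ ≤ C₁ * (‖z.1.1.1.2‖ + |∫ x in Ω, uᵢ z x|) := hP₁ z.1.1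
    have h2 : |∫ x in Ω, uᵢ z x| ≤ ‖ℓ‖ * ‖z.1.2.2.2‖ := by
      rw [integral_uᵢ_eq]
      exact (hℓ z.1.2.2.2) ▸ ℓ.le_opNorm z.1.2.2.2
    have hs : 0 ≤ ‖z.1.1.1.2‖ := norm_nonneg _
    have ht : 0 ≤ ‖z.1.2.2.2‖ := norm_nonneg _
    exact le_mul_add_of_le hC₁ hC₂ (norm_nonneg ℓ) hs ht h1 h2
  · have h1 : ‖z.1.2.1.1.1‖ ≤ C₂ * (‖z.1.2.1.1.2‖ + |∫ x in Ω, uₑ z x|) := hP₂ z.1.2.1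
    have h0 : ∫ x in Ω, uₑ z x = 0 := z.2.1
    rw [h0, abs_zero, add_zero] at h1
    have hs : 0 ≤ ‖z.1.2.1.1.2‖ := norm_nonneg _
    have hle : C₂ ≤ C₁ * (1 + ‖ℓ‖) + C₂ := le_add_of_nonneg_left (by positivity)
    exact h1.trans (mul_le_mul_of_nonneg_right hle hs)

theorem L2_norm_le_of_lintegral_le {α : Type*} [MeasurableSpace α] {μ : Measure α}
    (f : Lp ℝ 2 μ) {M : ℝ} (hM : 0 ≤ M)
    (hf : ∫⁻ x, ENNReal.ofReal (f x ^ 2) ∂μ ≤ ENNReal.ofReal M) : ‖f‖ ≤ 1 + M := by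
  refine norm_le_of_lintegral_le (by norm_num) f hM (le_trans (le_of_eq ?_) hf)
  refine lintegral_congr fun x => ?_
  rw [ENNReal.toReal_ofNat, ← ofReal_norm,
    ENNReal.ofReal_rpow_of_nonneg (norm_nonneg _) (by norm_num)]
  norm_num

/-- Sublevel sets of the energy are bounded. -/
theorem exists_norm_le_of_nonnegEnergy_le {Qᵢ Qₑ : Eucl N → Eucl N → ℝ} (hp₂ : p ≠ ⊤)
    (hΩ : IsC1Domain Ω) (hΩ' : IsC1Domain Ω') (hQᵢ : IsFluxPotential p Ω Qᵢ)
    (hQₑ : IsFluxPotential p Ω' Qₑ) {G : ℝ × ℝ → ℝ} (hG : ∀ z, z.1 ^ 2 + z.2 ^ 2 ≤ G z)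
    {M : ℝ} (hM : 0 ≤ M) :
    ∃ R : ℝ, ∀ z : EnergySpace p hsub hb, nonnegEnergy Qᵢ Qₑ G z ≤ ENNReal.ofReal M →
      ‖z‖ ≤ R := by
  obtain ⟨R₁, hR₁⟩ := hQᵢ.exists_norm_le hΩ.isOpen.measurableSet hp₂ M
  obtain ⟨R₂, hR₂⟩ := hQₑ.exists_norm_le hΩ'.isOpen.measurableSet hp₂ M
  obtain ⟨C, hC, hP⟩ := exists_norm_components_le (hsub := hsub) (hb := hb) hp₂ hΩ hΩ'
  refine ⟨max (max (C * (R₁ + (1 + M))) R₁) (max (max (C * R₂) R₂) (1 + M)), fun z hz => ?_⟩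
  have k₁ : ‖z.1.1.1.2‖ ≤ R₁ := hR₁ _ (le_trans (by
    rw [nonnegEnergy, add_assoc]; exact le_self_add) hz)
  have k₂ : ‖z.1.2.1.1.2‖ ≤ R₂ := hR₂ _ (le_trans (by
    rw [nonnegEnergy, add_right_comm]; exact le_add_self) hz)
  have kG : (∫⁻ x in Ω, ENNReal.ofReal (G (vComp z x, wComp z x))) ≤ ENNReal.ofReal M :=
    le_trans (by rw [nonnegEnergy]; exact le_add_self) hz
  have k₃ : ‖z.1.2.2.1‖ ≤ 1 + M := L2_norm_le_of_lintegral_le _ hM (le_trans (lintegral_mono fun x =>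
    ENNReal.ofReal_le_ofReal (le_trans (le_add_of_nonneg_left (sq_nonneg (vComp z x)))
      (hG (vComp z x, wComp z x)))) kG)
  have k₄ : ‖z.1.2.2.2‖ ≤ 1 + M := L2_norm_le_of_lintegral_le _ hM (le_trans (lintegral_mono fun x =>
    ENNReal.ofReal_le_ofReal (le_trans (le_add_of_nonneg_right (sq_nonneg (wComp z x)))
      (hG (vComp z x, wComp z x)))) kG)
  have k₅ := (hP z).2.trans (mul_le_mul_of_nonneg_left k₂ hC)
  have k₆ := (hP z).1.trans (mul_le_mul_of_nonneg_left (add_le_add k₁ k₄) hC)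
  exact max_le_max (max_le_max k₆ k₁) (max_le_max (max_le_max k₅ k₂) (max_le k₃ k₄))

end EnergyFormula

/-! ### Test functions: finite energy and density. -/

section TestFunctions

variable {N : ℕ} {p : ℝ≥0∞} {Ω Ω' : Set (Eucl N)} {φ ψ : Eucl N → ℝ}

/-- `φ ∈ C_c^∞(Ω)`. -/
structure IsTestFunction (Ω : Set (Eucl N)) (φ : Eucl N → ℝ) : Prop where
  contDiff : ContDiff ℝ (⊤ : ℕ∞) φ
  hasCompactSupport : HasCompactSupport φ
  tsupport_subset : tsupport φ ⊆ Ω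

theorem IsTestFunction.memLp (hφ : IsTestFunction Ω φ) (q : ℝ≥0∞) : MemLp φ q (leb Ω) :=
  (hφ.contDiff.continuous.memLp_of_hasCompactSupport hφ.hasCompactSupport).restrict Ω

theorem IsTestFunction.continuous_gradient (hφ : IsTestFunction Ω φ) : Continuous (gradient φ) :=
  (InnerProductSpace.toDual ℝ (Eucl N)).symm.continuous.comp
    (hφ.contDiff.continuous_fderiv (by simp))

theorem IsTestFunction.hasCompactSupport_gradient (hφ : IsTestFunction Ω φ) :
    HasCompactSupport (gradient φ) :=
  (hφ.hasCompactSupport.fderiv ℝ).comp_left (g := (InnerProductSpace.toDual ℝ (Eucl N)).symm)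
    (map_zero _)

theorem IsTestFunction.memLp_gradient (hφ : IsTestFunction Ω φ) (q : ℝ≥0∞) :
    MemLp (gradient φ) q (leb Ω) :=
  (hφ.continuous_gradient.memLp_of_hasCompactSupport hφ.hasCompactSupport_gradient).restrict Ω

theorem gradient_eq_zero_of_notMem_tsupport {x : Eucl N}
    (hx : x ∉ tsupport φ) : gradient φ x = 0 := by
  have h : fderiv ℝ φ x = 0 :=
    image_eq_zero_of_notMem_tsupport fun h => hx (tsupport_fderiv_subset ℝ h)
  rw [gradient, h, map_zero]

theorem IsTestFunction.isWeakGradient (hφ : IsTestFunction Ω φ) :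
    IsWeakGradient Ω φ (gradient φ) := by
  intro η hη hηc hηs y
  have h0 : ∀ x ∉ Ω, η x = 0 := fun x hx =>
    image_eq_zero_of_notMem_tsupport fun h => hx (hηs h)
  have h1 : ∀ x ∉ Ω, φ x = 0 := fun x hx =>
    image_eq_zero_of_notMem_tsupport fun h => hx (hφ.tsupport_subset h)
  rw [setIntegral_eq_integral_of_forall_compl_eq_zero fun x hx => by rw [h1 x hx, mul_zero],
    setIntegral_eq_integral_of_forall_compl_eq_zero fun x hx => by rw [h0 x hx, zero_mul]]
  simp only [inner_gradient_left]
  have hdη : Continuous fun x => fderiv ℝ η x y :=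
    (hη.continuous_fderiv (by simp)).clm_apply continuous_const
  have hdφ : Continuous fun x => fderiv ℝ φ x y :=
    (hφ.contDiff.continuous_fderiv (by simp)).clm_apply continuous_const
  rw [integral_mul_fderiv_eq_neg_fderiv_mul_of_integrable, neg_neg]
  · exact (hdη.mul hφ.contDiff.continuous).integrable_of_hasCompactSupport
      hφ.hasCompactSupport.mul_left
  · exact (hη.continuous.mul hdφ).integrable_of_hasCompactSupport hηc.mul_right
  · exact (hη.continuous.mul hφ.contDiff.continuous).integrable_of_hasCompactSupport hηc.mul_right
  · exact fun x _ => hη.differentiable (by simp) x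
  · exact fun x _ => hφ.contDiff.differentiable (by simp) x

/-- A test function as an element of the Sobolev space. -/
def IsTestFunction.toSobolev (hφ : IsTestFunction Ω φ) (p : ℝ≥0∞) [Fact (1 ≤ p)] : Sobolev p Ω :=
  ⟨((hφ.memLp p).toLp φ, (hφ.memLp_gradient p).toLp (gradient φ)), by
    intro η hη hηc hηs y
    have h := hφ.isWeakGradient η hη hηc hηs y
    have e1 : ∫ x in Ω, fderiv ℝ η x y * (hφ.memLp p).toLp φ x =
        ∫ x in Ω, fderiv ℝ η x y * φ x := by
      refine integral_congr_ae ?_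
      filter_upwards [(hφ.memLp p).coeFn_toLp] with x hx
      rw [hx]
    have e2 : ∫ x in Ω, η x * inner ℝ ((hφ.memLp_gradient p).toLp (gradient φ) x) y =
        ∫ x in Ω, η x * inner ℝ (gradient φ x) y := by
      refine integral_congr_ae ?_
      filter_upwards [(hφ.memLp_gradient p).coeFn_toLp] with x hx
      rw [hx]
    exact e1.trans (h.trans (congrArg Neg.neg e2.symm))⟩

/-- The element `(φ, 0, ψ)` of the energy space. -/
def testElement (p : ℝ≥0∞) [Fact (1 ≤ p)] (hsub : Ω ⊆ Ω') (hb : Bornology.IsBounded Ω)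
    (hφ : IsTestFunction Ω φ) (hψ : IsTestFunction Ω ψ) : EnergySpace p hsub hb :=
  ⟨(hφ.toSobolev p, 0, (hψ.memLp 2).toLp ψ, (hφ.memLp 2).toLp φ), by
    have h0 : ((0 : Lp ℝ p (leb Ω')) : Eucl N → ℝ) =ᵐ[leb Ω] 0 :=
      ae_mono (Measure.restrict_mono hsub le_rfl) (Lp.coeFn_zero ℝ p (leb Ω'))
    refine ⟨integral_eq_zero_of_ae h0, ?_⟩
    filter_upwards [h0, (hφ.memLp 2).coeFn_toLp, (hφ.memLp p).coeFn_toLp] with x h1 h2 h3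
    refine h2.trans ?_
    refine Eq.trans ?_ (congrArg₂ (· - ·) h3 h1).symm
    simp⟩

/-- The values of ∇φ lie in a ball contained in the convex hull of a finite set t. By convexity and
nonnegativity, Q(x, ∇φ(x)) ≤ ∑ Q(x, v) over v ∈ t, which is integrable on the compact support of φ;
off the support, Q(x, 0) = 0. -/
theorem IsFluxPotential.lintegral_gradient_lt_top {Q : Eucl N → Eucl N → ℝ} (hΩ : IsOpen Ω)
    (hQ : IsFluxPotential p Ω Q) (hloc : ∀ y, LocallyIntegrableOn (fun x => Q x y) Ω volume)
    (hφ : IsTestFunction Ω φ) : ∫⁻ x in Ω, ENNReal.ofReal (Q x (gradient φ x)) < ⊤ := by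
  obtain ⟨R, hR⟩ := hφ.hasCompactSupport_gradient.exists_bound_of_continuous hφ.continuous_gradient
  obtain ⟨t, ht, -⟩ := (convex_closedBall (0 : Eucl N) R).exists_subset_interior_convexHull_finset_of_isCompact
    (isCompact_closedBall _ _) univ_mem
  have hle : ∀ x ∈ Ω, Q x (gradient φ x) ≤
      (tsupport φ).indicator (fun x => ∑ v ∈ t, Q x v) x := by
    intro x hx
    by_cases hxs : x ∈ tsupport φ
    · rw [Set.indicator_of_mem hxs]
      obtain ⟨v, hv, hv'⟩ := (hQ.strictConvexOn x hx).convexOn.exists_ge_of_mem_convexHull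
        (t := (t : Set (Eucl N))) (Set.subset_univ _) (interior_subset (ht (by simpa using hR x)))
      exact hv'.trans (Finset.single_le_sum (fun w _ => hQ.nonneg hx w) hv)
    · rw [Set.indicator_of_notMem hxs, gradient_eq_zero_of_notMem_tsupport hxs, hQ.map_zero x hx]
  have h_int : IntegrableOn (fun x => ∑ v ∈ t, Q x v) (tsupport φ) volume :=
    integrable_finsetSum _ fun v _ => (hloc v).integrableOn_compact_subset hφ.tsupport_subset
      hφ.hasCompactSupport
  have h_int' : Integrable ((tsupport φ).indicator fun x => ∑ v ∈ t, Q x v) (leb Ω) :=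
    ((integrable_indicator_iff (isClosed_tsupport φ).measurableSet).2 h_int).restrict
  exact lt_of_le_of_lt (setLIntegral_mono' hΩ.measurableSet fun x hx =>
    ENNReal.ofReal_le_ofReal (hle x hx)) h_int'.lintegral_lt_top

variable [Fact (1 ≤ p)] {hsub : Ω ⊆ Ω'} {hb : Bornology.IsBounded Ω}

theorem nonnegEnergy_testElement_lt_top {Qᵢ Qₑ : Eucl N → Eucl N → ℝ} (hΩ : IsOpen Ω)
    (hΩ' : MeasurableSet Ω') (hQᵢ : IsFluxPotential p Ω Qᵢ) (hQₑ : IsFluxPotential p Ω' Qₑ)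
    (hloc : ∀ y, LocallyIntegrableOn (fun x => Qᵢ x y) Ω volume) {G : ℝ × ℝ → ℝ}
    (hG : Continuous G) (hφ : IsTestFunction Ω φ) (hψ : IsTestFunction Ω ψ) :
    nonnegEnergy Qᵢ Qₑ G (testElement p hsub hb hφ hψ) < ⊤ := by
  have h1 : ∫⁻ x in Ω, ENNReal.ofReal (Qᵢ x (gradUᵢ (testElement p hsub hb hφ hψ) x)) < ⊤ := by
    refine lt_of_eq_of_lt (lintegral_congr_ae ?_) (hQᵢ.lintegral_gradient_lt_top hΩ hloc hφ)
    filter_upwards [(hφ.memLp_gradient p).coeFn_toLp] with x hx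
    exact congrArg (fun y => ENNReal.ofReal (Qᵢ x y)) hx
  have h2 : ∫⁻ x in Ω', ENNReal.ofReal (Qₑ x (gradUₑ (testElement p hsub hb hφ hψ) x)) < ⊤ := by
    refine lt_of_eq_of_lt (b := ∫⁻ _ in Ω', 0) (lintegral_congr_ae ?_) (by simp)
    filter_upwards [Lp.coeFn_zero (Eucl N) p (leb Ω'), ae_restrict_mem hΩ'] with x hx hxΩ
    have e : Qₑ x (gradUₑ (testElement p hsub hb hφ hψ) x) = Qₑ x 0 := congrArg (Qₑ x) hx
    rw [e, hQₑ.map_zero x hxΩ, ENNReal.ofReal_zero]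
  have h3 : ∫⁻ x in Ω, ENNReal.ofReal (G (vComp (testElement p hsub hb hφ hψ) x,
      wComp (testElement p hsub hb hφ hψ) x)) < ⊤ := by
    obtain ⟨R, hR⟩ := hφ.hasCompactSupport.exists_bound_of_continuous hφ.contDiff.continuous
    obtain ⟨S, hS⟩ := hψ.hasCompactSupport.exists_bound_of_continuous hψ.contDiff.continuous
    obtain ⟨B, hB⟩ := (isCompact_closedBall (0 : ℝ × ℝ) (max R S)).exists_bound_of_continuousOn
      hG.continuousOn
    refine lt_of_le_of_lt (b := ∫⁻ _ in Ω, ENNReal.ofReal B) (lintegral_mono_ae ?_) ?_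
    · filter_upwards [(hφ.memLp 2).coeFn_toLp, (hψ.memLp 2).coeFn_toLp] with x k1 k2
      have e : (vComp (testElement p hsub hb hφ hψ) x, wComp (testElement p hsub hb hφ hψ) x) =
        (φ x, ψ x) := Prod.ext k1 k2
      rw [e]
      refine ENNReal.ofReal_le_ofReal ((le_abs_self _).trans (hB _ ?_))
      rw [mem_closedBall_zero_iff]
      exact max_le_max (hR x) (hS x)
    · rw [setLIntegral_const]
      exact ENNReal.mul_lt_top ENNReal.ofReal_lt_top hb.measure_lt_top
  exact ENNReal.add_lt_top.2 ⟨ENNReal.add_lt_top.2 ⟨h1, h2⟩, h3⟩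

/-- Test functions in `L²(Ω)`. -/
def testSubmodule (Ω : Set (Eucl N)) : Submodule ℝ (Lp ℝ 2 (leb Ω)) where
  carrier := {f | ∃ (φ : Eucl N → ℝ) (hφ : IsTestFunction Ω φ), f = (hφ.memLp 2).toLp φ}
  zero_mem' := ⟨0, ⟨contDiff_const, HasCompactSupport.zero, by simp⟩, (MemLp.toLp_zero _).symm⟩
  add_mem' := by
    rintro _ _ ⟨φ, hφ, rfl⟩ ⟨ψ, hψ, rfl⟩
    refine ⟨φ + ψ, ⟨hφ.contDiff.add hψ.contDiff, hφ.hasCompactSupport.add hψ.hasCompactSupport,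
      (tsupport_add _ _).trans (Set.union_subset hφ.tsupport_subset hψ.tsupport_subset)⟩, ?_⟩
    rw [← MemLp.toLp_add]
  smul_mem' := by
    rintro c _ ⟨φ, hφ, rfl⟩
    refine ⟨c • φ, ⟨hφ.contDiff.const_smul c, hφ.hasCompactSupport.smul_left,
      (closure_mono (Function.support_const_smul_subset c φ)).trans hφ.tsupport_subset⟩, ?_⟩
    rw [← MemLp.toLp_const_smul]

/-- An L² function orthogonal to all test functions vanishes a.e. by the fundamental lemma of the
calculus of variations. -/
theorem dense_testSubmodule (hΩ : IsOpen Ω) (hb : Bornology.IsBounded Ω) :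
    Dense (testSubmodule Ω : Set (Lp ℝ 2 (leb Ω))) := by
  have := isFiniteMeasure_leb hb
  rw [Submodule.dense_iff_topologicalClosure_eq_top, Submodule.topologicalClosure_eq_top_iff,
    Submodule.eq_bot_iff]
  intro f hf
  have hfi : Integrable f (leb Ω) := (Lp.memLp f).integrable (by norm_num)
  have h := hΩ.ae_eq_zero_of_integral_contDiff_smul_eq_zero (μ := leb Ω) (f := f)
    (hfi.locallyIntegrable.locallyIntegrableOn Ω) fun φ h1 h2 h3 => by
      have hφ : IsTestFunction Ω φ := ⟨h1, h2, h3⟩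
      have h4 := (Submodule.mem_orthogonal _ _).1 hf _ ⟨φ, hφ, rfl⟩
      rw [L2.inner_def] at h4
      rw [← h4]
      refine integral_congr_ae ?_
      filter_upwards [(hφ.memLp 2).coeFn_toLp] with x hx
      rw [hx]
      simp [mul_comm]
  rw [Lp.eq_zero_iff_ae_eq_zero]
  filter_upwards [h, ae_restrict_mem hΩ.measurableSet] with x hx hxΩ
  exact hx hxΩ

theorem dense_jMap_image (hΩ : IsOpen Ω) {D : Set (EnergySpace p hsub hb)}
    (hD : ∀ (φ ψ : Eucl N → ℝ) (hφ : IsTestFunction Ω φ) (hψ : IsTestFunction Ω ψ),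
      testElement p hsub hb hφ hψ ∈ D) : Dense (jMap p hsub hb '' D) := by
  have h1 := (dense_testSubmodule hΩ hb).prod (dense_testSubmodule hΩ hb)
  let e := (WithLp.prodContinuousLinearEquiv 2 ℝ (Lp ℝ 2 (leb Ω)) (Lp ℝ 2 (leb Ω))).symm
  have h2 := e.surjective.denseRange.dense_image e.continuous h1
  refine h2.mono ?_
  rintro _ ⟨⟨f, g⟩, ⟨⟨φ, hφ, rfl⟩, ⟨ψ, hψ, rfl⟩⟩, rfl⟩
  exact ⟨_, hD φ ψ hφ hψ, rfl⟩

end TestFunctions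

/-! ### Extended real arithmetic. -/

section ExtendedReal

theorem coe_sub_real_ne_bot (a : ℝ≥0∞) (r : ℝ) : (a : EReal) - (r : EReal) ≠ ⊥ := by
  by_cases h : a = ⊤
  · simp [h]
  · rw [coe_ennreal_eq_coe_toReal h, ← EReal.coe_sub]
    exact EReal.coe_ne_bot _

theorem coe_sub_real_lt_top {a : ℝ≥0∞} {r : ℝ} : (a : EReal) - (r : EReal) < ⊤ ↔ a < ⊤ := by
  by_cases h : a = ⊤
  · simp [h]
  · rw [coe_ennreal_eq_coe_toReal h, ← EReal.coe_sub]
    exact iff_of_true (EReal.coe_lt_top _) (lt_top_iff_ne_top.2 h)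

theorem coe_ennreal_lt_top {a : ℝ≥0∞} : (a : EReal) < ⊤ ↔ a < ⊤ := by
  simpa using coe_sub_real_lt_top (a := a) (r := 0)

theorem le_ofReal_of_coe_sub_le {a : ℝ≥0∞} {r c : ℝ} (h : (a : EReal) - (r : EReal) ≤ (c : EReal)) :
    a ≤ ENNReal.ofReal (c + r) := by
  have ha : a ≠ ⊤ := by
    rintro rfl
    simp at h
  rw [coe_ennreal_eq_coe_toReal ha, ← EReal.coe_sub, EReal.coe_le_coe_iff] at h
  rw [← ENNReal.ofReal_toReal ha]
  exact ENNReal.ofReal_le_ofReal (by linarith)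

theorem lowerSemicontinuous_coe_sub {X : Type*} [TopologicalSpace X] {K : X → ℝ≥0∞} {r : X → ℝ}
    (hK : LowerSemicontinuous K) (hr : Continuous r) :
    LowerSemicontinuous fun x => (K x : EReal) - (r x : EReal) := by
  have h1 : LowerSemicontinuous fun x => (K x : EReal) :=
    continuous_coe_ennreal_ereal.comp_lowerSemicontinuous hK fun _ _ h => by simpa using h
  have h2 : LowerSemicontinuous fun x => ((-r x : ℝ) : EReal) :=
    (continuous_coe_real_ereal.comp hr.neg).lowerSemicontinuous
  -- Addition on `EReal` is continuous here because the second summand is finite.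
  have h3 := h1.add' h2 fun x => EReal.continuousAt_add (Or.inr (EReal.coe_ne_bot _))
    (Or.inr (EReal.coe_ne_top _))
  simpa only [EReal.coe_neg, ← sub_eq_add_neg] using h3

end ExtendedReal

/-! ### Abstract ellipticity and lower semicontinuity. -/

section Elliptic

variable {V H : Type*} [NormedAddCommGroup V] [NormedSpace ℝ V] [NormedAddCommGroup H]
  [InnerProductSpace ℝ H] {E : V → EReal} {j : V →L[ℝ] H} {K : V → ℝ≥0∞} {n : V → ℝ} {ω c : ℝ}

theorem shifted_eq_sub (hn : ∀ z, ‖j z‖ ^ 2 = n z)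
    (hE : ∀ z, E z = (K z : EReal) - ((ω / 2 * n z + c : ℝ) : EReal)) :
    shifted E j ω = fun z => (K z : EReal) - (c : EReal) := by
  ext z
  rw [shifted, hE, hn, sub_eq_add_neg, ← EReal.coe_neg, add_assoc, ← EReal.coe_add,
    sub_eq_add_neg, ← EReal.coe_neg]
  congr 2
  ring

/-- Shifting by exactly this ω cancels the quadratic term, leaving K - c; its sublevel sets are
bounded, and reflexivity does the rest. -/
theorem isJElliptic_of_eq_sub (hV : IsReflexiveSpace V) (hn : ∀ z, ‖j z‖ ^ 2 = n z)
    (hE : ∀ z, E z = (K z : EReal) - ((ω / 2 * n z + c : ℝ) : EReal))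
    (hK : ∀ u v : V, ∀ a b : ℝ, 0 ≤ a → 0 ≤ b → a + b = 1 →
      K (a • u + b • v) ≤ ENNReal.ofReal a * K u + ENNReal.ofReal b * K v)
    (hbdd : ∀ M : ℝ, 0 ≤ M → ∃ R : ℝ, ∀ z, K z ≤ ENNReal.ofReal M → ‖z‖ ≤ R) :
    IsJElliptic E j := by
  refine ⟨ω, ?_, fun d => hV.isCompact_closure ?_⟩
  · rw [shifted_eq_sub hn hE]
    exact isConvexFun_of_ennreal hK
  · obtain ⟨R, hR⟩ := hbdd _ (le_max_right (d + c) 0)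
    refine isBounded_iff_forall_norm_le.2 ⟨R, fun z hz => hR z ?_⟩
    rw [shifted_eq_sub hn hE] at hz
    exact (le_ofReal_of_coe_sub_le hz).trans (ENNReal.ofReal_le_ofReal (le_max_left _ _))

theorem lowerSemicontinuous_of_eq_sub (hn : ∀ z, ‖j z‖ ^ 2 = n z)
    (hE : ∀ z, E z = (K z : EReal) - ((ω / 2 * n z + c : ℝ) : EReal))
    (hK : LowerSemicontinuous K) : LowerSemicontinuous E := by
  rw [funext hE]
  refine lowerSemicontinuous_coe_sub hK ?_
  simp_rw [← hn]
  fun_prop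

end Elliptic

end Bidomain

end

/-! ### The theorem. -/

set_option maxHeartbeats 1000000 in
theorem lemma1 {N : ℕ} (p : ENNReal) [Fact (1 ≤ p)] (hp₁ : 1 < p) (hp₂ : p ≠ ⊤)
    {Ω Ω' : Set (Bidomain.Eucl N)}
    (hΩ : Bidomain.IsC1Domain Ω) (hΩ' : Bidomain.IsC1Domain Ω') (hsub : Ω ⊆ Ω')
    (Qᵢ Qₑ : Bidomain.Eucl N → Bidomain.Eucl N → ℝ)
    (hQᵢ : Bidomain.IsFluxPotential p Ω Qᵢ) (hQₑ : Bidomain.IsFluxPotential p Ω' Qₑ)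
    (F : ℝ × ℝ → ℝ) (hF : ContDiff ℝ 1 F) (hF' : Bidomain.IsSemiconvex F) :
    (∀ z, Bidomain.energy p hsub hΩ.isBounded Qᵢ Qₑ F z ≠ ⊥) ∧
    LowerSemicontinuous (Bidomain.energy p hsub hΩ.isBounded Qᵢ Qₑ F) ∧
    Bidomain.IsJElliptic (Bidomain.energy p hsub hΩ.isBounded Qᵢ Qₑ F)
      (Bidomain.jMap p hsub hΩ.isBounded) ∧
    Bidomain.effDom (Bidomain.energy p hsub hΩ.isBounded Qᵢ Qₑ F) =
      {z | Bidomain.energyᵢ Qᵢ z < ⊤ ∧ Bidomain.energyₑ Qₑ z < ⊤ ∧ Bidomain.energyF F z < ⊤} ∧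
    ((∀ y, MeasureTheory.LocallyIntegrableOn (fun x => Qᵢ x y) Ω MeasureTheory.volume) →
      Dense (Bidomain.jMap p hsub hΩ.isBounded ''
        Bidomain.effDom (Bidomain.energy p hsub hΩ.isBounded Qᵢ Qₑ F))) := by
  open Bidomain in
  have hm := hΩ.isOpen.measurableSet
  have hm' := hΩ'.isOpen.measurableSet
  obtain ⟨ω, C, hconv, hlow⟩ := hF'.exists_convexOn (hF.differentiable (by simp))
  let G : ℝ × ℝ → ℝ := fun z => F z + (ω / 2 * (z.1 ^ 2 + z.2 ^ 2) + C)
  have hGc : Continuous G := by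
    have := hF.continuous
    fun_prop
  have hG0 : ∀ y, 0 ≤ G y := fun y => le_trans (by positivity) (hlow y)
  have hE := energy_eq (hsub := hsub) (hb := hΩ.isBounded) hm hm' hQᵢ hQₑ hF.continuous
    (G := G) (fun y => rfl) hG0
  have hn := norm_jMap_sq (p := p) (hsub := hsub) (hb := hΩ.isBounded)
  have hV := isReflexiveSpace_energySpace hp₁ hp₂ hm hsub hΩ.isBounded hΩ'.isBounded
  have hlsc := lowerSemicontinuous_nonnegEnergy (p := p) (hsub := hsub) (hb := hΩ.isBounded)
    hm hm' hQᵢ hQₑ hGc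
  have hfin : ∀ z, z ∈ effDom (energy p hsub hΩ.isBounded Qᵢ Qₑ F) ↔
      nonnegEnergy Qᵢ Qₑ G z < ⊤ := by
    intro z
    rw [effDom, Set.mem_ofPred_eq, hE, coe_sub_real_lt_top]
  refine ⟨fun z => ?_, ?_, ?_, ?_, fun hloc => ?_⟩
  -- A sum in `EReal` with a summand ⊥ is ⊥, so this one statement says that all three integrals
  -- exist in (-∞, +∞].
  · rw [hE]
    exact coe_sub_real_ne_bot _ _
  · exact lowerSemicontinuous_of_eq_sub hn hE hlsc
  · exact isJElliptic_of_eq_sub hV hn hE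
      (fun u v a b ha hb hab => nonnegEnergy_convex hm hm' hQᵢ hQₑ hGc hconv hG0 u v ha hb hab)
      fun M hM => exists_norm_le_of_nonnegEnergy_le hp₂ hΩ hΩ' hQᵢ hQₑ hlow hM
  · ext z
    rw [hfin, Set.mem_ofPred_eq, energyᵢ_eq hm hQᵢ, energyₑ_eq hm' hQₑ,
      energyF_eq hF.continuous (G := G) (fun y => rfl) hG0, coe_sub_real_lt_top, nonnegEnergy,
      ENNReal.add_lt_top, ENNReal.add_lt_top, and_assoc]
    simp only [coe_ennreal_lt_top]
  · refine dense_jMap_image hΩ.isOpen fun φ ψ hφ hψ => ?_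
    rw [hfin]
    exact nonnegEnergy_testElement_lt_top hΩ.isOpen hm' hQᵢ hQₑ hloc hGc hφ hψ
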